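/- For a finite group $G$ let $L(G)$ be the set of subgroups of $G$, and for $H\in L(G)$ let $L_1(H)$ be the set of cyclic subgroups of $H$. Define the relative cyclic subgroup commutativity degree $$csd(H,G)=\frac{|\{(H_1,G_1)\in L_1(H)\times L_1(G) : H_1G_1=G_1H_1\}|}{|L_1(H)|\,|L_1(G)|},$$ and let $f_1:L(G)\to[0,1]$, $f_1(H)=csd(H,G)$. Let $\gamma(G)$ be the number of conjugacy classes of non-normal subgroups of $G$. **Theorem.** Let $G$ be a finite group with $\gamma(G)=1$. Then $G$ is isomorphic to a group of one of the following two types: (1) $N\rtimes P$, where $N\cong\mathbb{Z}_p$, $P\cong\mathbb{Z}_{q^n}$, $n\ge 1$, $[N,\Phi(P)]=1$ (with $\Phi(P)$ the Frattini subgroup of $P$), and $p,q$ are primes with $q\mid p-1$; (2) $M(p^n)=\langle x,y \mid x^{p^{n-1}}=y^p=1,\ y^{-1}xy=x^{1+p^{n-2}}\rangle$, where $p$ is a prime, and $n\ge 3$ if $p\ge 3$, $n\ge 4$ if $p=2$; and $$|\mathrm{Im}\, f_1|=\begin{cases}3, & \text{if } G \text{ is of type (1)},\\ 1, & \text{if }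 G \text{ is of type (2)}.\end{cases}$$ -/

import Mathlib

open scoped Pointwise

/-- The set `L₁(H)` of cyclic subgroups of `H`, viewed as subgroups of the ambient group `G`. -/
def cyclicSubgroups {G : Type*} [Group G] (H : Subgroup G) : Set (Subgroup G) :=
  {K | K ≤ H ∧ IsCyclic K}

/-- The relative cyclic subgroup commutativity degree `csd(H, G)`: the proportion of pairs
`(H₁, G₁) ∈ L₁(H) × L₁(G)` with `H₁ G₁ = G₁ H₁` (equality of product sets). -/
noncomputable def csd {G : Type*} [Group G] (H : Subgroup G) : ℚ :=
  (({x : Subgroup G × Subgroup G |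
      x.1 ∈ cyclicSubgroups H ∧ x.2 ∈ cyclicSubgroups (⊤ : Subgroup G) ∧
        (x.1 : Set G) * (x.2 : Set G) = (x.2 : Set G) * (x.1 : Set G)}.ncard : ℕ) : ℚ) /
    (((cyclicSubgroups H).ncard : ℚ) * ((cyclicSubgroups (⊤ : Subgroup G)).ncard : ℚ))

/-- The number `|Im f₁|` of relative cyclic subgroup commutativity degrees of `G`, where
`f₁ : L(G) → [0,1]`, `f₁(H) = csd(H, G)`. -/
noncomputable def numRelCsd (G : Type*) [Group G] : ℕ :=
  (Set.range fun H : Subgroup G => csd H).ncard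

/-- The conjugacy class `[H]` of a subgroup `H`. -/
def subgroupConjClass {G : Type*} [Group G] (H : Subgroup G) : Set (Subgroup G) :=
  {K | ∃ g : G, K = H.map (MulAut.conj g).toMonoidHom}

/-- `γ(G)`: the number of conjugacy classes of non-normal subgroups of `G`. -/
noncomputable def gammaNonNormal (G : Type*) [Group G] : ℕ :=
  {C : Set (Subgroup G) | ∃ H : Subgroup G, ¬ H.Normal ∧ C = subgroupConjClass H}.ncard

/-- `G` is a semidirect product `N ⋊ P` with `N ≅ ℤ_p`, `P ≅ ℤ_{q^n}` (`n ≥ 1`) and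
`[N, Φ(P)] = 1`, where `p`, `q` are primes with `q ∣ p - 1`. -/
def IsCyclicSemidirect (G : Type*) [Group G] : Prop :=
  ∃ p q n : ℕ, p.Prime ∧ q.Prime ∧ q ∣ p - 1 ∧ 1 ≤ n ∧
    ∃ N P : Subgroup G, N.Normal ∧ N.IsComplement' P ∧
      Nonempty (N ≃* Multiplicative (ZMod p)) ∧
      Nonempty (P ≃* Multiplicative (ZMod (q ^ n))) ∧
      ⁅N, (frattini P).map P.subtype⁆ = ⊥

/-- The relators of `⟨x, y | x^{p^{n-1}} = y^p = 1, y⁻¹ x y = x^{1 + p^{n-2}}⟩`, where `x` and `y`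
are the free generators indexed by `0` and `1`. -/
def modularRels (p n : ℕ) : Set (FreeGroup (Fin 2)) :=
  {FreeGroup.of 0 ^ p ^ (n - 1),
   FreeGroup.of 1 ^ p,
   (FreeGroup.of 1)⁻¹ * FreeGroup.of 0 * FreeGroup.of 1 *
     (FreeGroup.of 0 ^ (1 + p ^ (n - 2)))⁻¹}

/-- The group `M(p^n)`, given by its presentation (used for `n ≥ 3`). -/
abbrev ModularMaxCyclicGroup (p n : ℕ) : Type := PresentedGroup (modularRels p n)

/-- `G ≅ M(p^n)` for a prime `p` and `n ≥ 3` if `p ≥ 3`, or `n ≥ 4` if `p = 2`. -/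
def IsModularMaxCyclic (G : Type*) [Group G] : Prop :=
  ∃ p n : ℕ, p.Prime ∧ (3 ≤ p ∧ 3 ≤ n ∨ p = 2 ∧ 4 ≤ n) ∧
    Nonempty (G ≃* ModularMaxCyclicGroup p n)

/-! ### Groups whose non-normal subgroups form one conjugacy class. -/

open scoped commutatorElement

/-! When `γ(G) = 1` all non-normal subgroups are conjugate and so have one order; a subgroup of any
other order, in particular one properly above or below a non-normal one, is normal. This passes to
quotients.

If a Sylow `q`-subgroup `P` is not normal, it is cyclic and self-normalizing, a subgroup `N` of
prime order `r ≠ q` is normal, and the Frattini argument gives `G = NP`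
(`isCyclicSemidirect_of_sylow`). If all Sylow subgroups are normal, `G` is a `p`-group
(`isPGroup_of_sylow_normal`). A non-normal cyclic `⟨h⟩` then has order `p`
(`orderOf_eq_prime_of_nonNormal`), commutators lie in a central subgroup of order `p`, the centre is
generated by some `g ^ p`, and `G = ⟨h⟩⟨g⟩` with the modular relation (`exists_modular_generators`).

For the degrees, `csd H` is one minus the proportion of non-permuting pairs, and only non-normal
subgroups occur in these. In type (2) commutators are central, so conjugate cyclic subgroups commute
elementwise and every value is 1. In type (1) the non-normal subgroups are the `p` conjugates of
`P`, of prime index, and no two permute; hence `csd H` depends only on whether `H` contains no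
conjugate of `P`, is one, or is `G`. A bound on the number of cyclic subgroups separates the three
values. -/

/-- Any two non-normal subgroups of `G` are conjugate. -/
def NonNormalConjugate (G : Type*) [Group G] : Prop :=
  ∀ A B : Subgroup G, ¬ A.Normal → ¬ B.Normal → ∃ g : G, B = A.map (MulAut.conj g).toMonoidHom

theorem nonNormalConjugate_of_gamma {G : Type*} [Group G] (hG : gammaNonNormal G = 1) :
    NonNormalConjugate G := by
  intro A B hA hB
  obtain ⟨C, hC⟩ := Set.ncard_eq_one.1 hG
  have h1 : subgroupConjClass A = C := by
    have : subgroupConjClass A ∈ ({C} : Set _) := hC ▸ ⟨A, hA, rfl⟩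
    exact this
  have h2 : subgroupConjClass B = C := by
    have : subgroupConjClass B ∈ ({C} : Set _) := hC ▸ ⟨B, hB, rfl⟩
    exact this
  have h3 : B ∈ subgroupConjClass A := by
    rw [h1, ← h2]
    refine ⟨1, ?_⟩
    ext x
    simp
  exact h3

theorem exists_nonNormal_of_gamma {G : Type*} [Group G] (hG : gammaNonNormal G = 1) :
    ∃ H : Subgroup G, ¬ H.Normal := by
  by_contra! h
  have : {C : Set (Subgroup G) | ∃ H : Subgroup G, ¬ H.Normal ∧ C = subgroupConjClass H} = ∅ := by
    ext C
    simp [h]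
  rw [gammaNonNormal, this] at hG
  simp at hG

theorem exists_zpowers_not_normal {G : Type*} [Group G] {H : Subgroup G} (hH : ¬ H.Normal) :
    ∃ h ∈ H, ¬ (Subgroup.zpowers h).Normal := by
  by_contra! hc
  exact hH ⟨fun x hx g => Subgroup.zpowers_le.2 hx
    ((hc x hx).conj_mem x (Subgroup.mem_zpowers x) g)⟩

section conj

variable {G : Type*} [Group G]

theorem card_map_conj (H : Subgroup G) (g : G) :
    Nat.card (H.map (MulAut.conj g).toMonoidHom) = Nat.card H :=
  Nat.card_congr (H.equivMapOfInjective _ (MulAut.conj g).injective).toEquiv.symm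

namespace NonNormalConjugate

theorem normal_of_card_ne (hG : NonNormalConjugate G) {H A : Subgroup G} (hH : ¬ H.Normal)
    (hA : Nat.card A ≠ Nat.card H) : A.Normal := by
  by_contra hn
  obtain ⟨g, rfl⟩ := hG H A hH hn
  exact hA (card_map_conj H g)

theorem normal_of_lt [Finite G] (hG : NonNormalConjugate G) {H A : Subgroup G} (hH : ¬ H.Normal)
    (hA : A < H) : A.Normal :=
  hG.normal_of_card_ne hH (Set.ncard_lt_ncard (t := (H : Set G)) hA).ne

theorem normal_of_gt [Finite G] (hG : NonNormalConjugate G) {H A : Subgroup G} (hH : ¬ H.Normal)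
    (hA : H < A) : A.Normal :=
  hG.normal_of_card_ne hH (Set.ncard_lt_ncard (t := (A : Set G)) hA).ne'

theorem exists_eq_conj_zpow (hG : NonNormalConjugate G) {h w : G}
    (hh : ¬ (Subgroup.zpowers h).Normal) (hw : ¬ (Subgroup.zpowers w).Normal) :
    ∃ (g : G) (i : ℤ), w = g * h ^ i * g⁻¹ := by
  obtain ⟨g, hg⟩ := hG _ _ hh hw
  have : w ∈ (Subgroup.zpowers h).map (MulAut.conj g).toMonoidHom := hg ▸ Subgroup.mem_zpowers w
  obtain ⟨_, ⟨i, rfl⟩, rfl⟩ := this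
  exact ⟨g, i, by simp⟩

theorem quotient (hG : NonNormalConjugate G) (N : Subgroup G) [N.Normal] :
    NonNormalConjugate (G ⧸ N) := by
  intro A B hA hB
  have hs := QuotientGroup.mk'_surjective N
  have key : ∀ C : Subgroup (G ⧸ N), ¬ C.Normal → ¬ (C.comap (QuotientGroup.mk' N)).Normal := by
    intro C hC h
    apply hC
    have := h.map (QuotientGroup.mk' N) hs
    rwa [Subgroup.map_comap_eq_self_of_surjective hs] at this
  obtain ⟨g, hg⟩ := hG _ _ (key A hA) (key B hB)
  refine ⟨QuotientGroup.mk' N g, ?_⟩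
  rw [← Subgroup.map_comap_eq_self_of_surjective hs B, hg]
  ext y
  constructor
  · rintro ⟨_, ⟨x, hx, rfl⟩, rfl⟩
    exact ⟨QuotientGroup.mk' N x, hx, by simp⟩
  · rintro ⟨x, hx, rfl⟩
    obtain ⟨x, rfl⟩ := hs x
    exact ⟨_, ⟨x, hx, rfl⟩, by simp⟩

end NonNormalConjugate

end conj

/-! ### Central elements of finite `p`-groups. -/

section pgroup

variable {G : Type*} [Group G] [Finite G] {p : ℕ} [Fact p.Prime]

/-- A nontrivial normal subgroup of a finite `p`-group contains a central element of order `p`. -/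
theorem IsPGroup.exists_mem_center_orderOf_eq (hp : IsPGroup p G) {N : Subgroup G} (hN : N.Normal)
    (hbot : N ≠ ⊥) : ∃ z ∈ N, z ∈ Subgroup.center G ∧ orderOf z = p := by
  have hc : IsPGroup p (ConjAct G) := hp
  have hcard : p ∣ Nat.card N := by
    rcases (hp.to_subgroup N).card_eq_or_dvd with h | h
    · exact absurd (Subgroup.card_eq_one.1 h) hbot
    · exact h
  have h1 : (1 : N) ∈ MulAction.fixedPoints (ConjAct G) N := by
    intro g; simp
  obtain ⟨b, hb, hne⟩ := hc.exists_fixed_point_of_prime_dvd_card_of_fixed_point N hcard h1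
  have hbc : (b : G) ∈ Subgroup.center G := by
    rw [Subgroup.mem_center_iff]
    intro g
    have h2 : g * (b : G) * g⁻¹ = b := congrArg Subtype.val (hb (ConjAct.toConjAct g))
    exact mul_inv_eq_iff_eq_mul.1 h2
  have hne' : (b : G) ≠ 1 := fun h => hne (Subtype.ext h.symm)
  obtain ⟨k, hk⟩ := IsPGroup.iff_orderOf.1 hp (b : G)
  have hk0 : k ≠ 0 := by
    rintro rfl
    exact hne' (orderOf_eq_one_iff.1 (by simpa using hk))
  obtain ⟨k, rfl⟩ := Nat.exists_eq_succ_of_ne_zero hk0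
  refine ⟨(b : G) ^ p ^ k, N.pow_mem b.2 _, Subgroup.pow_mem _ hbc _, ?_⟩
  rw [orderOf_pow, hk, pow_succ, Nat.gcd_mul_right_left, Nat.mul_div_cancel_left]
  exact pow_pos (Fact.out : p.Prime).pos k

theorem IsPGroup.le_center_of_card_eq_prime (hp : IsPGroup p G) {N : Subgroup G} (hN : N.Normal)
    (hc : Nat.card N = p) : N ≤ Subgroup.center G := by
  have hbot : N ≠ ⊥ := by
    rintro rfl
    rw [Subgroup.card_bot] at hc
    exact (Fact.out : p.Prime).one_lt.ne hc
  obtain ⟨z, hz, hzc, ho⟩ := hp.exists_mem_center_orderOf_eq hN hbot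
  have : Subgroup.zpowers z = N := by
    apply Subgroup.eq_of_le_of_card_ge (Subgroup.zpowers_le.2 hz)
    rw [Nat.card_zpowers, ho, hc]
  rw [← this]
  exact Subgroup.zpowers_le.2 hzc

end pgroup

/-! ### Cyclic subgroups and power formulas in class two. -/

section cyclic

variable {G : Type*} [Group G]

/-- In the cyclic group `⟨x⟩` the equation `u ^ k = 1` has at most `k` solutions; for `k = orderOf
b` the elements of `⟨b⟩` exhaust them. -/
theorem mem_zpowers_of_pow_orderOf_eq_one {x a b : G} (hx : IsOfFinOrder x)
    (ha : a ∈ Subgroup.zpowers x) (hb : b ∈ Subgroup.zpowers x) (hab : a ^ orderOf b = 1) :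
    a ∈ Subgroup.zpowers b := by
  have hfin : Finite (Subgroup.zpowers x) := finite_zpowers.2 hx
  have hbf : Finite (Subgroup.zpowers b) := by
    refine finite_zpowers.2 ?_
    obtain ⟨i, rfl⟩ := hb
    exact hx.zpow
  have hpos : 0 < orderOf b := orderOf_pos_iff.2 (finite_zpowers.1 hbf)
  have : Fintype (Subgroup.zpowers x) := Fintype.ofFinite _
  classical
  have h1 := IsCyclic.card_pow_eq_one_le (α := Subgroup.zpowers x) hpos
  let S : Finset (Subgroup.zpowers x) := Finset.univ.filter (fun u => u ^ orderOf b = 1)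
  let T : Finset (Subgroup.zpowers x) := Finset.univ.filter (fun u => (u : G) ∈ Subgroup.zpowers b)
  have hTS : T ⊆ S := by
    intro u hu
    obtain ⟨i, hi⟩ := (Finset.mem_filter.1 hu).2
    refine Finset.mem_filter.2 ⟨Finset.mem_univ _, Subtype.ext ?_⟩
    simp only [Subgroup.coe_pow, Subgroup.coe_one, ← hi]
    rw [← zpow_natCast, ← zpow_mul, mul_comm, zpow_mul, zpow_natCast, pow_orderOf_eq_one, one_zpow]
  have hle : Subgroup.zpowers b ≤ Subgroup.zpowers x := Subgroup.zpowers_le.2 hb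
  have hT : T.card = orderOf b := by
    rw [← Nat.card_zpowers, ← Nat.card_congr (Subgroup.subgroupOfEquivOfLe hle).toEquiv,
      Nat.card_eq_fintype_card, Fintype.card_subtype]
    congr 1
  have hST : T = S := Finset.eq_of_subset_of_card_le hTS (by rw [hT]; exact h1)
  have : (⟨a, ha⟩ : Subgroup.zpowers x) ∈ S :=
    Finset.mem_filter.2 ⟨Finset.mem_univ _, Subtype.ext (by simpa using hab)⟩
  rw [← hST] at this
  exact (Finset.mem_filter.1 this).2

theorem pow_mul_eq_of_commutator_commute {a b c : G} (hba : b * a = a * b * c) (hcb : Commute c b)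
    (n : ℕ) : b ^ n * a = a * b ^ n * c ^ n := by
  induction n with
  | zero => simp
  | succ n ih =>
    have e : c ^ n * b = b * c ^ n := (hcb.pow_left n).eq
    calc b ^ (n + 1) * a = b ^ n * (b * a) := by rw [pow_succ, mul_assoc]
      _ = b ^ n * a * (b * c) := by rw [hba]; simp only [mul_assoc]
      _ = a * b ^ n * (c ^ n * b) * c := by rw [ih]; simp only [mul_assoc]
      _ = a * b ^ (n + 1) * c ^ (n + 1) := by
        rw [e, pow_succ, pow_succ]; simp only [mul_assoc]

/-- The power formula in a group of nilpotency class two. -/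
theorem mul_pow_eq_of_commutator_commute {a b c : G} (hba : b * a = a * b * c) (hca : Commute c a)
    (hcb : Commute c b) (n : ℕ) : (a * b) ^ n = a ^ n * b ^ n * c ^ n.choose 2 := by
  induction n with
  | zero => simp
  | succ n ih =>
    have e : c ^ n.choose 2 * a = a * c ^ n.choose 2 := (hca.pow_left _).eq
    have e' : ∀ k, c ^ k * b = b * c ^ k := fun k => (hcb.pow_left _).eq
    calc (a * b) ^ (n + 1) = a ^ n * b ^ n * (c ^ n.choose 2 * a) * b := by
          rw [pow_succ, ih]; simp only [mul_assoc]
      _ = a ^ n * (b ^ n * a) * (c ^ n.choose 2 * b) := by rw [e]; simp only [mul_assoc]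
      _ = a ^ n * a * b ^ n * (c ^ n * b) * c ^ n.choose 2 := by
          rw [pow_mul_eq_of_commutator_commute hba hcb, e']; simp only [mul_assoc]
      _ = a ^ (n + 1) * b ^ (n + 1) * c ^ (n + 1).choose 2 := by
          rw [e', Nat.choose_succ_succ' n 1, Nat.choose_one_right, pow_add c, pow_succ, pow_succ]
          simp only [mul_assoc]

theorem commutator_zpow_left {x y : G} (hx : Commute ⁅x, y⁆ x) (n : ℤ) :
    ⁅x ^ n, y⁆ = ⁅x, y⁆ ^ n := by
  have h1 : y * x⁻¹ * y⁻¹ = x⁻¹ * ⁅x, y⁆ := by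
    rw [commutatorElement_def]; group
  have h2 : y * (x ^ n)⁻¹ * y⁻¹ = (x ^ n)⁻¹ * ⁅x, y⁆ ^ n := by
    have : y * (x ^ n)⁻¹ * y⁻¹ = (y * x⁻¹ * y⁻¹) ^ n := by
      rw [← inv_zpow]; exact (map_zpow (MulAut.conj y) x⁻¹ n)
    rw [this, h1, (hx.symm.inv_left).mul_zpow, inv_zpow]
  calc ⁅x ^ n, y⁆ = x ^ n * (y * (x ^ n)⁻¹ * y⁻¹) := by
        rw [commutatorElement_def]; simp only [mul_assoc]
    _ = _ := by rw [h2, mul_inv_cancel_left]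

end cyclic

/-! ### Derived subgroup and centre of a `p`-group. -/

section pgroup

variable {G : Type*} [Group G] [Finite G] {p : ℕ} [hpF : Fact p.Prime]

/-- A finite `p`-group with a central element `z` of order `p` such that every cyclic subgroup
not centralised modulo `z` is normal and contains `z` has derived subgroup inside `⟨z⟩`. -/
theorem commutator_mem_zpowers_of_normal (hp : IsPGroup p G) {z : G} (hz : orderOf z = p)
    (H : ∀ g : G, (∀ x : G, ⁅x, g⁆ ∈ Subgroup.zpowers z) ∨
      ((Subgroup.zpowers g).Normal ∧ z ∈ Subgroup.zpowers g)) (x y : G) :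
    ⁅x, y⁆ ∈ Subgroup.zpowers z := by
  have hp2 : p.Prime := hpF.out
  have hsymm : ∀ x y : G, ⁅x, y⁆ ∈ Subgroup.zpowers z → ⁅y, x⁆ ∈ Subgroup.zpowers z := by
    intro x y h
    rw [← commutatorElement_inv]
    exact inv_mem h
  -- In a counterexample with `|x| + |y|` minimal, `⟨x⟩` and `⟨y⟩` are both normal, so `c = ⁅x, y⁆`
  -- lies in both and commutes with `x` and `y`.
  suffices key : ∀ (n : ℕ) (x y : G), orderOf x + orderOf y = n → orderOf y ≤ orderOf x →
      ⁅x, y⁆ ∈ Subgroup.zpowers z by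
    rcases le_total (orderOf y) (orderOf x) with h | h
    · exact key _ x y rfl h
    · exact hsymm _ _ (key _ y x rfl h)
  intro n
  induction n using Nat.strong_induction_on with
  | _ n ih =>
  intro x y hn hxy
  by_contra hbad
  have small : ∀ a b : G, orderOf a + orderOf b < n → ⁅a, b⁆ ∈ Subgroup.zpowers z := by
    intro a b hab
    rcases le_total (orderOf b) (orderOf a) with h | h
    · exact ih _ hab a b rfl h
    · exact hsymm _ _ (ih _ hab b a (add_comm _ _) h)
  obtain ⟨hyN, hzy⟩ := (H y).resolve_left (fun h => hbad (h x))
  obtain ⟨hxN, hzx⟩ := (H x).resolve_left (fun h => hbad (hsymm _ _ (h y)))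
  set c := ⁅x, y⁆ with hc
  have hcx : c ∈ Subgroup.zpowers x := by
    have := mul_mem (Subgroup.mem_zpowers x)
      (hxN.conj_mem x⁻¹ (inv_mem (Subgroup.mem_zpowers x)) y)
    rwa [← mul_assoc, ← mul_assoc, ← commutatorElement_def] at this
  have hcy : c ∈ Subgroup.zpowers y :=
    mul_mem (hyN.conj_mem y (Subgroup.mem_zpowers y) x) (inv_mem (Subgroup.mem_zpowers y))
  have comm_of_mem : ∀ {a b : G}, a ∈ Subgroup.zpowers b → Commute a b := by
    rintro a b ⟨i, rfl⟩
    exact (Commute.refl b).zpow_left i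
  have hCx : Commute c x := comm_of_mem hcx
  have hCy : Commute c y := comm_of_mem hcy
  have hpow : ∀ i : ℤ, ⁅x ^ i, y⁆ = c ^ i := commutator_zpow_left hCx
  have hx1 : x ≠ 1 := by rintro rfl; exact hbad (by simp [hc])
  have hcp : c ^ p ∈ Subgroup.zpowers z := by
    have hlt : orderOf (x ^ p) < orderOf x := by
      rw [orderOf_pow]
      refine Nat.div_lt_self (orderOf_pos x) ?_
      rw [Nat.gcd_eq_right (hp.dvd_orderOf hx1)]
      exact hp2.one_lt
    have := small (x ^ p) y (by omega)
    have e := hpow p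
    simp only [zpow_natCast] at e
    rwa [e] at this
  -- `⟨z⟩` holds every solution of `w ^ p = 1` in the cyclic group `⟨x⟩`.
  have hcp1 : c ^ p ≠ 1 := by
    intro h
    exact hbad (mem_zpowers_of_pow_orderOf_eq_one (isOfFinOrder_of_finite x) hcx hzx (by rwa [hz]))
  have hcp2 : orderOf c = p ^ 2 := by
    refine orderOf_eq_prime_pow (n := 1) (by simpa using hcp1) ?_
    obtain ⟨i, hi⟩ := hcp
    have hi : z ^ i = c ^ p := hi
    rw [show p ^ (1 + 1) = p * p by ring, pow_mul, ← hi, ← zpow_natCast, ← zpow_mul, mul_comm,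
      zpow_mul, zpow_natCast, ← hz, pow_orderOf_eq_one, one_zpow]
  -- If `|a| ≤ p ^ 3`, then `a ^ p` lies in `⟨c⟩`, the subgroup of order `p ^ 2`, and commutes with
  -- `x` and `y`; this forces `c ^ p = 1`.
  have big : ∀ a : G, c ∈ Subgroup.zpowers a → (a = x ∨ a = y) →
      ∃ l, orderOf a = p ^ (l + 4) := by
    intro a hca hab
    obtain ⟨k, hk⟩ := IsPGroup.iff_orderOf.1 hp a
    by_cases hk4 : 4 ≤ k
    · exact ⟨k - 4, by rw [hk]; congr 1; omega⟩
    exfalso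
    have h1 : a ^ p ∈ Subgroup.zpowers c := by
      refine mem_zpowers_of_pow_orderOf_eq_one (isOfFinOrder_of_finite a)
        (pow_mem (Subgroup.mem_zpowers a) _) hca ?_
      rw [hcp2, ← pow_mul, ← pow_succ', ← orderOf_dvd_iff_pow_eq_one, hk]
      exact pow_dvd_pow _ (by omega)
    obtain ⟨i, hi⟩ := h1
    have hi : c ^ i = a ^ p := hi
    rcases hab with rfl | rfl
    · have := hpow p
      rw [zpow_natCast, ← hi, commutatorElement_eq_one_iff_commute.2 (hCy.zpow_left i),
        zpow_natCast] at this
      exact hcp1 this.symm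
    · have hCy' : Commute ⁅a, x⁆ a := by rw [← commutatorElement_inv]; exact hCy.inv_left
      have := commutator_zpow_left hCy' p
      rw [zpow_natCast, ← hi, commutatorElement_eq_one_iff_commute.2 (hCx.zpow_left i),
        zpow_natCast, ← commutatorElement_inv, inv_pow] at this
      exact hcp1 (inv_eq_one.1 this.symm)
  obtain ⟨k, hk⟩ := big x hcx (Or.inl rfl)
  obtain ⟨l, hl⟩ := big y hcy (Or.inr rfl)
  have hlk : l ≤ k := by
    rw [hk, hl, Nat.pow_le_pow_iff_right hp2.one_lt] at hxy
    omega
  set t := p ^ (l + 2) with ht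
  have hyt : y ^ t ∈ Subgroup.zpowers (x ^ p ^ (k + 2)) := by
    have h1 : y ^ t ∈ Subgroup.zpowers c := by
      refine mem_zpowers_of_pow_orderOf_eq_one (isOfFinOrder_of_finite y)
        (pow_mem (Subgroup.mem_zpowers y) _) hcy ?_
      rw [hcp2, ← pow_mul, ht, ← pow_add, ← orderOf_dvd_iff_pow_eq_one, hl]
    refine mem_zpowers_of_pow_orderOf_eq_one (isOfFinOrder_of_finite x)
      (Subgroup.zpowers_le.2 hcx h1) (pow_mem (Subgroup.mem_zpowers x) _) ?_
    have : orderOf (x ^ p ^ (k + 2)) = p ^ 2 := by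
      rw [orderOf_pow, hk, Nat.gcd_eq_right (pow_dvd_pow _ (by omega)),
        Nat.pow_div (by omega) hp2.pos]
      congr 1; omega
    rw [this, ← pow_mul, ht, ← pow_add, ← orderOf_dvd_iff_pow_eq_one, hl]
  obtain ⟨r, hr⟩ := hyt
  have hr : (x ^ p ^ (k + 2)) ^ r = y ^ t := hr
  -- Chosen so that `(x ^ m) ^ t * y ^ t = 1`. Then `(x ^ m * y) ^ t` is a power of `c` with
  -- exponent divisible by `p`, so `x ^ m * y` has smaller order than `y` but the same commutator
  -- with `x`, against minimality.
  set m : ℤ := -(r * p ^ (k - l)) with hm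
  have hbt : (x ^ m) ^ t * y ^ t = 1 := by
    rw [← hr, ← zpow_natCast, ← zpow_natCast, ← zpow_mul, ← zpow_mul, ← zpow_add, hm, ht]
    have : -(r * (p : ℤ) ^ (k - l)) * ((p ^ (l + 2) : ℕ) : ℤ) +
        ((p ^ (k + 2) : ℕ) : ℤ) * r = 0 := by
      push_cast
      have : (p : ℤ) ^ (k + 2) = p ^ (k - l) * p ^ (l + 2) := by
        rw [← pow_add]; congr 1; omega
      rw [this]; ring
    rw [this, zpow_zero]
  have hcm : y * x ^ m = x ^ m * y * c ^ (-m) := by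
    have h1 := hpow m
    rw [commutatorElement_def, mul_inv_eq_iff_eq_mul, mul_inv_eq_iff_eq_mul] at h1
    have h2 : Commute (c ^ (-m)) (c ^ m * y * x ^ m) :=
      (((Commute.refl c).zpow_zpow _ _).mul_right (hCy.zpow_left _)).mul_right
        (hCx.zpow_zpow _ _)
    rw [h1, ← h2.eq]
    simp [mul_assoc]
  have hwt := mul_pow_eq_of_commutator_commute hcm (hCx.zpow_zpow _ _) (hCy.zpow_left _) t
  rw [hbt, one_mul] at hwt
  have hdvd : p ∣ t.choose 2 := by
    refine hp2.dvd_choose_pow two_ne_zero ?_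
    have : 2 ^ (l + 2) ≤ p ^ (l + 2) := Nat.pow_le_pow_left hp2.two_le _
    have h4 : 2 ^ (l + 2) ≥ 4 := by
      rw [pow_add]; have := Nat.one_le_two_pow (n := l); omega
    omega
  obtain ⟨e, he⟩ := hdvd
  have hcm2 : (c ^ (-m)) ^ p ^ 2 = 1 := by
    rw [← hcp2, ← zpow_natCast, ← zpow_mul, mul_comm, zpow_mul, zpow_natCast, pow_orderOf_eq_one,
      one_zpow]
  have hw : orderOf (x ^ m * y) ∣ p ^ (l + 3) := by
    rw [orderOf_dvd_iff_pow_eq_one, show l + 3 = (l + 2) + 1 by ring, pow_succ, pow_mul, ← ht, hwt,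
      he, ← pow_mul, show p * e * p = p ^ 2 * e by ring, pow_mul, hcm2, one_pow]
  have hlt : orderOf (x ^ m * y) < orderOf y := by
    rw [hl]
    exact (Nat.le_of_dvd (pow_pos hp2.pos _) hw).trans_lt
      (Nat.pow_lt_pow_right hp2.one_lt (by omega))
  have hfin := small x (x ^ m * y) (by omega)
  have : ⁅x, x ^ m * y⁆ = c := by
    have h1 : ⁅x, x ^ m * y⁆ = x ^ m * ⁅x, y⁆ * (x ^ m)⁻¹ := by
      rw [commutatorElement_def, commutatorElement_def]
      group
    rw [h1, ← hc, ← (hCx.zpow_right m).eq, mul_inv_cancel_right]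
  exact hbad (this ▸ hfin)

/-- In a finite `p`-group the centre is cyclic as soon as it has a unique subgroup of order `p`. -/
theorem exists_generator_center (hp : IsPGroup p G) {z : G} (hz : orderOf z = p)
    (hzc : z ∈ Subgroup.center G)
    (H : ∀ w ∈ Subgroup.center G, w ^ p = 1 → w ∈ Subgroup.zpowers z) :
    ∃ c ∈ Subgroup.center G, z ∈ Subgroup.zpowers c ∧
      ∀ w ∈ Subgroup.center G, w ∈ Subgroup.zpowers c := by
  have hp2 : p.Prime := hpF.out
  obtain ⟨c, hcm, hmax⟩ := Set.exists_max_image (Subgroup.center G : Set G) orderOf (Set.toFinite _)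
    ⟨z, hzc⟩
  obtain ⟨e, he⟩ := IsPGroup.iff_orderOf.1 hp c
  have he0 : e ≠ 0 := by
    rintro rfl
    have := hmax z hzc
    rw [hz, he, pow_zero] at this
    exact absurd hp2.one_lt (by omega)
  obtain ⟨e, rfl⟩ := Nat.exists_eq_succ_of_ne_zero he0
  have hoc : orderOf (c ^ p ^ e) = p := by
    rw [orderOf_pow, he, pow_succ, Nat.gcd_mul_right_left, Nat.mul_div_cancel_left]
    exact pow_pos hp2.pos e
  have hzcz : z ∈ Subgroup.zpowers c := by
    have h1 : c ^ p ^ e ∈ Subgroup.zpowers z :=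
      H _ (pow_mem hcm _) ((orderOf_dvd_iff_pow_eq_one).1 hoc.dvd)
    have h2 : z ∈ Subgroup.zpowers (c ^ p ^ e) :=
      mem_zpowers_of_pow_orderOf_eq_one (isOfFinOrder_of_finite z) (Subgroup.mem_zpowers z) h1
        (by rw [hoc, ← hz, pow_orderOf_eq_one])
    exact Subgroup.zpowers_le.2 (pow_mem (Subgroup.mem_zpowers c) _) h2
  refine ⟨c, hcm, hzcz, ?_⟩
  suffices key : ∀ (n : ℕ) (w : G), w ∈ Subgroup.center G → orderOf w = n →
      w ∈ Subgroup.zpowers c from fun w hw => key _ w hw rfl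
  intro n
  induction n using Nat.strong_induction_on with
  | _ n ih =>
  intro w hw hn
  by_cases hw1 : w = 1
  · rw [hw1]; exact one_mem _
  have hlt : orderOf (w ^ p) < n := by
    rw [← hn, orderOf_pow]
    refine Nat.div_lt_self (orderOf_pos w) ?_
    rw [Nat.gcd_eq_right (hp.dvd_orderOf hw1)]
    exact hp2.one_lt
  obtain ⟨j, hj⟩ := ih _ hlt (w ^ p) (pow_mem hw _) rfl
  have hj : c ^ j = w ^ p := hj
  have hwle : w ^ p ^ (e + 1) = 1 := by
    obtain ⟨f, hf⟩ := IsPGroup.iff_orderOf.1 hp w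
    rw [← orderOf_dvd_iff_pow_eq_one, hf]
    have := hmax w hw
    rw [hf, he, Nat.pow_le_pow_iff_right hp2.one_lt] at this
    exact pow_dvd_pow _ this
  -- The order of `w` divides that of `c`, so `w ^ p` cannot generate `⟨c⟩`. Dividing `w` by a
  -- `p`-th root of `w ^ p` in `⟨c⟩` leaves an element killed by `p`.
  have hpj : (p : ℤ) ∣ j := by
    have h1 : c ^ (j * (p ^ e : ℕ)) = 1 := by
      rw [zpow_mul, hj, zpow_natCast, ← pow_mul, ← pow_succ', hwle]
    rw [← orderOf_dvd_iff_zpow_eq_one, he] at h1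
    push_cast at h1
    rw [pow_succ, mul_comm] at h1
    exact Int.dvd_of_mul_dvd_mul_right (by exact_mod_cast pow_ne_zero e hp2.ne_zero) h1
  obtain ⟨i, rfl⟩ := hpj
  have hcomm : Commute w (c ^ (-i)) := ((Subgroup.mem_center_iff.1 hw) _).symm
  have h2 : (w * c ^ (-i)) ^ p = 1 := by
    rw [hcomm.mul_pow, ← hj, ← zpow_natCast, ← zpow_mul, ← zpow_add]
    have : (p : ℤ) * i + -i * p = 0 := by ring
    rw [this, zpow_zero]
  have h3 := Subgroup.zpowers_le.2 hzcz
    (H _ (mul_mem hw (zpow_mem hcm _)) h2)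
  have h4 := mul_mem h3 (zpow_mem (Subgroup.mem_zpowers c) i)
  simpa [mul_assoc] using h4

end pgroup

theorem normal_zpowers_of_mem_center {G : Type*} [Group G] {z : G} (hz : z ∈ Subgroup.center G) :
    (Subgroup.zpowers z).Normal := by
  refine ⟨fun x hx g => ?_⟩
  rw [Subgroup.mem_center_iff.1 (Subgroup.zpowers_le.2 hz hx) g, mul_inv_cancel_right]
  exact hx

/-! ### `p`-groups with a non-normal subgroup of order `p`. -/

section nonNormalPrime

variable {G : Type*} [Group G] [Finite G] {p : ℕ} [hpF : Fact p.Prime]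

/-- `⟨h, w⟩` properly contains `⟨h⟩`, hence is normal; its image in `G / ⟨w⟩` is normal of order
`p`, hence central. -/
theorem commutator_mem_zpowers_of_nonNormal (hp : IsPGroup p G) (hG : NonNormalConjugate G) {h : G}
    (ho : orderOf h = p) (hn : ¬ (Subgroup.zpowers h).Normal) {w : G} (hw : orderOf w = p)
    (hwc : w ∈ Subgroup.center G) (g : G) : ⁅g, h⁆ ∈ Subgroup.zpowers w := by
  have hN := normal_zpowers_of_mem_center hwc
  have hne : h ∉ Subgroup.zpowers w := fun hh =>
    hn (normal_zpowers_of_mem_center (Subgroup.zpowers_le.2 hwc hh))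
  have hlt : Subgroup.zpowers h < Subgroup.zpowers h ⊔ Subgroup.zpowers w := by
    refine lt_of_le_of_ne le_sup_left fun he => ?_
    have h1 : Subgroup.zpowers w ≤ Subgroup.zpowers h := by rw [he]; exact le_sup_right
    have h2 := Subgroup.eq_of_le_of_card_ge h1 (by rw [Nat.card_zpowers, Nat.card_zpowers, ho, hw])
    exact hne (h2 ▸ Subgroup.mem_zpowers h)
  have hK := hG.normal_of_gt hn hlt
  set f := QuotientGroup.mk' (Subgroup.zpowers w) with hf
  have hKf := hK.map f (QuotientGroup.mk'_surjective _)
  have hbot : (Subgroup.zpowers w).map f = ⊥ := by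
    rw [Subgroup.map_eq_bot_iff, hf, QuotientGroup.ker_mk']
  rw [Subgroup.map_sup, hbot, sup_bot_eq, MonoidHom.map_zpowers] at hKf
  have hof : orderOf (f h) = p := by
    refine orderOf_eq_prime ?_ ?_
    · rw [← map_pow, ← ho, pow_orderOf_eq_one, map_one]
    · intro h1
      exact hne ((QuotientGroup.eq_one_iff h).1 h1)
  have hc := (hp.to_quotient (Subgroup.zpowers w)).le_center_of_card_eq_prime hKf
    (by rw [Nat.card_zpowers, hof]) (Subgroup.mem_zpowers (f h))
  rw [← QuotientGroup.ker_mk' (Subgroup.zpowers w), MonoidHom.mem_ker, map_commutatorElement,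
    commutatorElement_eq_one_iff_commute]
  exact Subgroup.mem_center_iff.1 hc _

/-- The structure of a finite `p`-group whose non-normal subgroups are all conjugate to a subgroup
`⟨h⟩` of order `p`: it has a cyclic subgroup `⟨x⟩` of index `p` on which a power of `h` acts by
`x ↦ x ^ (1 + |x| / p)`. -/
theorem exists_modular_generators (hp : IsPGroup p G) (hG : NonNormalConjugate G) {h : G}
    (ho : orderOf h = p) (hn : ¬ (Subgroup.zpowers h).Normal) :
    ∃ (x : G) (k n : ℕ), (p = 2 → 1 ≤ n) ∧ ¬ p ∣ k ∧ orderOf x = p ^ (n + 2) ∧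
      x * h ^ k = h ^ k * x ^ (1 + p ^ (n + 1)) ∧ h ∉ Subgroup.zpowers x ∧
      ∀ w, ∃ i j : ℤ, w = h ^ j * x ^ i := by
  have hp2 : p.Prime := hpF.out
  have hpZ : Prime (p : ℤ) := Nat.prime_iff_prime_int.1 hp2
  have hh1 : h ≠ 1 := by
    rintro rfl
    rw [orderOf_one] at ho
    exact hp2.one_lt.ne ho
  have hncen : ∃ g, ¬ Commute g h := by
    by_contra! hc
    exact hn (normal_zpowers_of_mem_center (Subgroup.mem_center_iff.2 hc))
  obtain ⟨z, -, hzc, hz⟩ := hp.exists_mem_center_orderOf_eq (N := ⊤) inferInstance (by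
    intro ht
    have : h ∈ (⊤ : Subgroup G) := trivial
    rw [ht] at this
    exact hh1 (Subgroup.mem_bot.1 this))
  have hzp : z ^ p = 1 := by rw [← hz, pow_orderOf_eq_one]
  have hhp : h ^ p = 1 := orderOf_dvd_iff_pow_eq_one.1 ho.dvd
  have hcomm := fun g => commutator_mem_zpowers_of_nonNormal hp hG ho hn hz hzc g
  -- the only central elements of order `p` are in `⟨z⟩`
  have huniq : ∀ w ∈ Subgroup.center G, w ^ p = 1 → w ∈ Subgroup.zpowers z := by
    intro w hwc hwp
    by_contra hwz
    have hw : orderOf w = p := orderOf_eq_prime hwp (by rintro rfl; exact hwz (one_mem _))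
    obtain ⟨g, hg⟩ := hncen
    -- A nontrivial `⁅g, h⁆` lies in both `⟨w⟩` and `⟨z⟩`, so it generates both.
    have h1 := commutator_mem_zpowers_of_nonNormal hp hG ho hn hw hwc g
    apply hg
    rw [← commutatorElement_eq_one_iff_commute]
    by_contra hne
    have h2 := hcomm g
    have hoc : orderOf ⁅g, h⁆ = p := by
      refine orderOf_eq_prime ?_ hne
      obtain ⟨i, hi⟩ := h2
      have hi : z ^ i = ⁅g, h⁆ := hi
      rw [← hi, ← zpow_natCast, ← zpow_mul, mul_comm, zpow_mul, zpow_natCast, hzp, one_zpow]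
    have h3 := mem_zpowers_of_pow_orderOf_eq_one (isOfFinOrder_of_finite w)
      (Subgroup.mem_zpowers w) h1 (by rwa [hoc])
    exact hwz (Subgroup.zpowers_le.2 h2 h3)
  have hmin : ∀ A : Subgroup G, A.Normal → A ≠ ⊥ → z ∈ A := by
    intro A hA hbot
    obtain ⟨w, hwA, hwc, hw⟩ := hp.exists_mem_center_orderOf_eq hA hbot
    have h1 := huniq w hwc (by rw [← hw, pow_orderOf_eq_one])
    have h2 := mem_zpowers_of_pow_orderOf_eq_one (isOfFinOrder_of_finite z)
      (Subgroup.mem_zpowers z) h1 (by rw [hw, hzp])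
    exact Subgroup.zpowers_le.2 hwA h2
  have hzcomm : ∀ (i : ℤ) (g : G), Commute (z ^ i) g := fun i g =>
    (Subgroup.mem_center_iff.1 (zpow_mem hzc i) g).symm
  -- elements of order `p`
  have hK : ∀ w : G, w ^ p = 1 → ∃ i j : ℤ, w = h ^ j * z ^ i := by
    intro w hwp
    by_cases hw1 : w = 1
    · exact ⟨0, 0, by simp [hw1]⟩
    by_cases hwn : (Subgroup.zpowers w).Normal
    · have hzw := hmin _ hwn (Subgroup.zpowers_ne_bot.2 hw1)
      obtain ⟨i, hi⟩ := mem_zpowers_of_pow_orderOf_eq_one (isOfFinOrder_of_finite w)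
        (Subgroup.mem_zpowers w) hzw (by rw [hz, hwp])
      exact ⟨i, 0, by rw [zpow_zero, one_mul]; exact hi.symm⟩
    · obtain ⟨g, j, rfl⟩ := hG.exists_eq_conj_zpow hn hwn
      obtain ⟨i, hi⟩ := hcomm g
      have hi : z ^ i = ⁅g, h⁆ := hi
      refine ⟨i * j, j, ?_⟩
      rw [commutatorElement_def, eq_mul_inv_iff_mul_eq] at hi
      have : g * h ^ j * g⁻¹ = (g * h * g⁻¹) ^ j := (map_zpow (MulAut.conj g) h j)
      rw [this, ← hi, (hzcomm i h).mul_zpow, ← zpow_mul, (hzcomm _ _).eq]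
  -- Elements killed by `p` are central modulo `z` by `hK`; any other element generates a subgroup
  -- of order different from `|h|`, which is normal and contains `z`.
  have hder : ∀ x y : G, ⁅x, y⁆ ∈ Subgroup.zpowers z := by
    refine commutator_mem_zpowers_of_normal hp hz ?_
    intro g
    by_cases hgp : g ^ p = 1
    · left
      intro x
      obtain ⟨i, j, rfl⟩ := hK g hgp
      have hN := normal_zpowers_of_mem_center hzc
      have hz1 : QuotientGroup.mk' (Subgroup.zpowers z) z = 1 :=
        (QuotientGroup.eq_one_iff z).2 (Subgroup.mem_zpowers z)
      rw [← QuotientGroup.ker_mk' (Subgroup.zpowers z), MonoidHom.mem_ker,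
        map_commutatorElement, commutatorElement_eq_one_iff_commute, map_mul, map_zpow, map_zpow,
        hz1, one_zpow, mul_one]
      have h2 := hcomm x
      rw [← QuotientGroup.ker_mk' (Subgroup.zpowers z), MonoidHom.mem_ker,
        map_commutatorElement, commutatorElement_eq_one_iff_commute] at h2
      exact h2.zpow_right j
    · right
      have hg1 : g ≠ 1 := by rintro rfl; exact hgp (one_pow p)
      have : (Subgroup.zpowers g).Normal := by
        refine hG.normal_of_card_ne hn ?_
        rw [Nat.card_zpowers, Nat.card_zpowers, ho]
        intro h1
        exact hgp (by rw [← h1, pow_orderOf_eq_one])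
      exact ⟨this, hmin _ this (Subgroup.zpowers_ne_bot.2 hg1)⟩
  have hzz : ∀ w ∈ Subgroup.zpowers z, w ^ p = 1 ∧ w ∈ Subgroup.center G := by
    rintro _ ⟨i, rfl⟩
    refine ⟨?_, zpow_mem hzc i⟩
    show (z ^ i) ^ p = 1
    rw [← zpow_natCast, ← zpow_mul, mul_comm, zpow_mul, zpow_natCast, hzp, one_zpow]
  have hcen : ∀ {d : G}, d ∈ Subgroup.center G → ∀ g, Commute d g := fun hd g =>
    (Subgroup.mem_center_iff.1 hd g).symm
  have hpcen : ∀ x : G, x ^ p ∈ Subgroup.center G := by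
    intro x
    rw [Subgroup.mem_center_iff]
    intro g
    have h1 := commutator_zpow_left (hcen (hzz _ (hder x g)).2 x) p
    rw [zpow_natCast, zpow_natCast, (hzz _ (hder x g)).1,
      commutatorElement_eq_one_iff_commute] at h1
    exact h1.eq.symm
  -- elements whose `p`-th power is a `p`-th power in the centre
  have hKc : ∀ c ∈ Subgroup.center G, ∀ v : G, v ^ p ∈ Subgroup.zpowers (c ^ p) →
      ∃ (j : ℤ), ∃ d ∈ Subgroup.center G, v = h ^ j * d := by
    rintro c hc v ⟨i, hi⟩
    have hi : (c ^ p) ^ i = v ^ p := hi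
    have h1 : (v * c ^ (-i)) ^ p = 1 := by
      rw [((hcen (zpow_mem hc _) v).symm).mul_pow, ← hi, ← zpow_natCast, ← zpow_natCast,
        ← zpow_mul, ← zpow_mul, ← zpow_add]
      have : (p : ℤ) * i + -i * p = 0 := by ring
      rw [this, zpow_zero]
    obtain ⟨i', j, hij⟩ := hK _ h1
    refine ⟨j, z ^ i' * c ^ i, mul_mem (zpow_mem hzc _) (zpow_mem hc _), ?_⟩
    rw [← mul_assoc, ← hij, mul_assoc, ← zpow_add, neg_add_cancel, zpow_zero, mul_one]
  have hcommh : ∀ (j : ℤ) (d : G), d ∈ Subgroup.center G → Commute (h ^ j * d) h := fun j d hd =>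
    ((Commute.refl h).zpow_left j).mul_left (hcen hd h)
  obtain ⟨c, hc, hzcc, hgen⟩ := exists_generator_center hp hz hzc huniq
  -- Otherwise `hKc` writes every element as a power of `h` times a central one, making `h` central.
  -- For this `g`, `g ^ p` is a power of `c` with exponent prime to `p`, so it generates the centre.
  obtain ⟨g, hg⟩ : ∃ g : G, g ^ p ∉ Subgroup.zpowers (c ^ p) := by
    by_contra! hall
    obtain ⟨a, ha⟩ := hncen
    obtain ⟨j, d, hd, rfl⟩ := hKc c hc a (hall a)
    exact ha (hcommh j d hd)
  have hcg : c ∈ Subgroup.zpowers (g ^ p) := by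
    obtain ⟨j, hj⟩ := hgen _ (hpcen g)
    have hj : c ^ j = g ^ p := hj
    have hpj : ¬ (p : ℤ) ∣ j := by
      rintro ⟨i, rfl⟩
      refine hg ⟨i, ?_⟩
      rw [← hj, zpow_mul, zpow_natCast]
    rw [← hj, mem_zpowers_zpow_iff]
    obtain ⟨e, he⟩ := IsPGroup.iff_orderOf.1 hp c
    rw [he]
    have h1 : IsCoprime j (p : ℤ) := (hpZ.coprime_iff_not_dvd.2 hpj).symm
    have h2 : IsCoprime j ((p ^ e : ℕ) : ℤ) := by
      push_cast
      exact h1.pow_right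
    exact Int.isCoprime_iff_gcd_eq_one.1 h2
  have hcenle : ∀ d ∈ Subgroup.center G, d ∈ Subgroup.zpowers (g ^ p) := fun d hd =>
    Subgroup.zpowers_le.2 hcg (hgen d hd)
  have hgpg : Subgroup.zpowers (g ^ p) ≤ Subgroup.zpowers g :=
    Subgroup.zpowers_le.2 (pow_mem (Subgroup.mem_zpowers g) p)
  have hzg := hcenle z hzc
  obtain ⟨n, hn1⟩ : ∃ n, orderOf (g ^ p) = p ^ (n + 1) := by
    obtain ⟨e, he⟩ := IsPGroup.iff_orderOf.1 hp (g ^ p)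
    rcases e with _ | e
    · rw [pow_zero, orderOf_eq_one_iff] at he
      rw [he, Subgroup.zpowers_one_eq_bot, Subgroup.mem_bot] at hzg
      rw [hzg, orderOf_one] at hz
      exact absurd hz hp2.one_lt.ne
    · exact ⟨e, he⟩
  have hog : orderOf g = p ^ (n + 2) := by
    refine orderOf_eq_prime_pow (n := n + 1) ?_ ?_
    · rw [pow_succ' p n, pow_mul, ← orderOf_dvd_iff_pow_eq_one, hn1,
        Nat.pow_dvd_pow_iff_le_right hp2.one_lt]
      omega
    · rw [pow_succ' p (n + 1), pow_mul, ← hn1, pow_orderOf_eq_one]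
  -- If `p = 2` and `n = 0`, the centre is `{1, z}`. For `a` not commuting with `h`, `a ^ 2 = ⁅a, h⁆
  -- = z`, so `(a * h) ^ 2 = 1`; then `a * h` commutes with `h`, and so does `a`.
  have hn2 : p = 2 → 1 ≤ n := by
    rintro rfl
    by_contra hn0
    obtain rfl : n = 0 := by omega
    obtain ⟨a, ha⟩ := hncen
    have h4 : ∀ w ∈ Subgroup.zpowers z, w ≠ 1 → w = z := by
      rintro _ ⟨i, rfl⟩ hne
      rcases Int.even_or_odd' i with ⟨k, rfl | rfl⟩
      · exact absurd (by simp [zpow_mul, hzp]) hne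
      · simp [zpow_add, zpow_mul, hzp]
    have ha2 : a ^ 2 = z := by
      apply h4
      · refine huniq _ (hpcen a) ?_
        obtain ⟨i, hi⟩ := hcenle _ (hpcen a)
        have hi : (g ^ 2) ^ i = a ^ 2 := hi
        have hg2 : (g ^ 2) ^ 2 = 1 := orderOf_dvd_iff_pow_eq_one.1 hn1.dvd
        rw [← hi, ← zpow_natCast, ← zpow_mul, mul_comm, zpow_mul, zpow_natCast, hg2, one_zpow]
      · intro h1
        obtain ⟨i, j, rfl⟩ := hK a h1
        exact ha (hcommh j _ (zpow_mem hzc i))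
    have hah : ⁅a, h⁆ = z :=
      h4 _ (hder a h) (fun h1 => ha (commutatorElement_eq_one_iff_commute.1 h1))
    rw [commutatorElement_def, mul_inv_eq_iff_eq_mul, mul_inv_eq_iff_eq_mul] at hah
    have h5 : (a * h) ^ 2 = 1 := by
      calc (a * h) ^ 2 = a * h * (a * h) := sq _
        _ = z * h * a ^ 2 * h := by
          rw [← mul_assoc (a * h) a h, hah, sq]; simp only [mul_assoc]
        _ = z * (h * z * h) := by rw [ha2]; simp only [mul_assoc]
        _ = z * z * (h * h) := by rw [← (hcen hzc h).eq]; simp only [mul_assoc]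
        _ = 1 := by rw [← sq, ← sq, hzp, hhp, one_mul]
    obtain ⟨i, j, hij⟩ := hK _ h5
    have h6 : Commute (a * h) h := hij ▸ hcommh j _ (zpow_mem hzc i)
    have h7 := h6.mul_left (Commute.refl h).inv_left
    rw [mul_inv_cancel_right] at h7
    exact ha h7
  -- With `w ^ p = (g ^ p) ^ j`, the `p`-th power of `w * g ^ (-j)` is `ζ ^ p.choose 2`. It is `1`
  -- for odd `p`, and for `p = 2` it lies in `⟨g ^ 4⟩` because `1 ≤ n`; so `hKc` applies with `g ^
  -- p` in place of `c`.
  have hrep : ∀ w, ∃ i j : ℤ, w = h ^ j * g ^ i := by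
    intro w
    obtain ⟨j, hj⟩ := hcenle _ (hpcen w)
    have hj : (g ^ p) ^ j = w ^ p := hj
    have hζ := hder (g ^ (-j))⁻¹ w⁻¹
    set ζ := ⁅(g ^ (-j))⁻¹, w⁻¹⁆ with hζd
    have hba : g ^ (-j) * w = w * g ^ (-j) * ζ := by
      rw [hζd, commutatorElement_def]; group
    have hv := mul_pow_eq_of_commutator_commute hba (hcen (hzz _ hζ).2 _) (hcen (hzz _ hζ).2 _) p
    have h1 : w ^ p * (g ^ (-j)) ^ p = 1 := by
      rw [← hj, ← zpow_natCast, ← zpow_natCast, ← zpow_mul, ← zpow_mul, ← zpow_add]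
      have : (p : ℤ) * j + -j * p = 0 := by ring
      rw [this, zpow_zero]
    rw [h1, one_mul] at hv
    have h2 : ζ ^ p.choose 2 ∈ Subgroup.zpowers ((g ^ p) ^ p) := by
      by_cases hp22 : p = 2
      · have hzgg : z ∈ Subgroup.zpowers ((g ^ p) ^ p) := by
          refine mem_zpowers_of_pow_orderOf_eq_one (isOfFinOrder_of_finite (g ^ p)) hzg
            (pow_mem (Subgroup.mem_zpowers _) _) ?_
          have : orderOf ((g ^ p) ^ p) = p ^ n := by
            rw [orderOf_pow, hn1, pow_succ, Nat.gcd_mul_left_left, Nat.mul_div_cancel _ hp2.pos]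
          rw [this, ← orderOf_dvd_iff_pow_eq_one, hz]
          exact dvd_pow_self p (by have := hn2 hp22; omega)
        exact pow_mem (Subgroup.zpowers_le.2 hzgg hζ) _
      · obtain ⟨e, he⟩ := hp2.dvd_choose_self two_ne_zero
          (lt_of_le_of_ne hp2.two_le (Ne.symm hp22))
        rw [he, pow_mul, (hzz _ hζ).1, one_pow]
        exact one_mem _
    obtain ⟨j', d, hd, hw⟩ := hKc (g ^ p) (hpcen g) _ (hv ▸ h2)
    obtain ⟨i, hi⟩ := hgpg (hcenle d hd)
    have hi : g ^ i = d := hi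
    refine ⟨i + j, j', ?_⟩
    rw [zpow_add, ← mul_assoc, hi, ← hw, mul_assoc, ← zpow_add, neg_add_cancel, zpow_zero, mul_one]
  have hgh : ¬ Commute g h := by
    intro hcgh
    obtain ⟨a, ha⟩ := hncen
    obtain ⟨i, j, rfl⟩ := hrep a
    exact ha (((Commute.refl h).zpow_left j).mul_left (hcgh.zpow_left i))
  have hζ := hder g⁻¹ h⁻¹
  set ζ := ⁅g⁻¹, h⁻¹⁆ with hζd
  have hba : g * h = h * g * ζ := by
    rw [hζd, commutatorElement_def]; group
  have hζ1 : ζ ≠ 1 := by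
    intro h1
    rw [h1, mul_one] at hba
    exact hgh hba
  have hζo : orderOf ζ = p := orderOf_eq_prime (hzz _ hζ).1 hζ1
  have hgk : ∀ k : ℕ, g * h ^ k = h ^ k * g * ζ ^ k := by
    intro k
    induction k with
    | zero => simp
    | succ k ih =>
      have e : ζ ^ k * h = h * ζ ^ k := ((hcen (hzz _ hζ).2 h).pow_left k).eq
      calc g * h ^ (k + 1) = g * h ^ k * h := by rw [pow_succ, mul_assoc]
        _ = h ^ k * (g * h) * ζ ^ k := by rw [ih, mul_assoc _ _ h, e]; simp only [mul_assoc]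
        _ = h ^ (k + 1) * g * ζ ^ (k + 1) := by
          rw [hba, pow_succ, pow_succ' ζ]; simp only [mul_assoc]
  -- Both have order `p` in the cyclic group `⟨g⟩`. Writing the power as `ζ ^ k` and passing from
  -- `h` to `h ^ k` gives the exponent `1 + p ^ (n + 1)` exactly.
  have hu : g ^ p ^ (n + 1) ∈ Subgroup.zpowers ζ := by
    refine mem_zpowers_of_pow_orderOf_eq_one (isOfFinOrder_of_finite g)
      (pow_mem (Subgroup.mem_zpowers g) _) (hgpg (Subgroup.zpowers_le.2 hzg hζ)) ?_
    rw [hζo, ← pow_mul, ← pow_succ, ← hog, pow_orderOf_eq_one]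
  rw [← mem_powers_iff_mem_zpowers] at hu
  obtain ⟨k, hk⟩ := hu
  have hk : ζ ^ k = g ^ p ^ (n + 1) := hk
  refine ⟨g, k, n, hn2, ?_, hog, ?_, ?_, hrep⟩
  · rintro ⟨e, rfl⟩
    rw [pow_mul, (hzz _ hζ).1, one_pow] at hk
    have := orderOf_dvd_iff_pow_eq_one.2 hk.symm
    rw [hog, Nat.pow_dvd_pow_iff_le_right hp2.one_lt] at this
    omega
  · rw [hgk, hk, pow_add g 1, pow_one, mul_assoc]
  · rintro ⟨i, hi⟩
    have hi : g ^ i = h := hi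
    exact hgh (hi ▸ (Commute.refl g).zpow_right i)

end nonNormalPrime

theorem not_normal_zpowers_mk {G : Type*} [Group G] {h : G} (hn : ¬ (Subgroup.zpowers h).Normal)
    (N : Subgroup G) [N.Normal] (hN : N ≤ Subgroup.zpowers h) :
    ¬ (Subgroup.zpowers (QuotientGroup.mk' N h)).Normal := by
  intro hc
  have h1 := hc.comap (QuotientGroup.mk' N)
  rw [← MonoidHom.map_zpowers, Subgroup.comap_map_eq, QuotientGroup.ker_mk', sup_eq_left.2 hN] at h1
  exact hn h1

theorem mem_zpowers_zpow_of_not_dvd {G : Type*} [Group G] {p : ℕ} (hp : p.Prime) {t : G} {e : ℕ}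
    (ht : orderOf t = p ^ e) {i : ℤ} (hi : ¬ (p : ℤ) ∣ i) : t ∈ Subgroup.zpowers (t ^ i) := by
  rw [mem_zpowers_zpow_iff, ht]
  have h1 : IsCoprime i (p : ℤ) :=
    ((Nat.prime_iff_prime_int.1 hp).coprime_iff_not_dvd.2 hi).symm
  have h2 : IsCoprime i ((p ^ e : ℕ) : ℤ) := by
    push_cast
    exact h1.pow_right
  exact Int.isCoprime_iff_gcd_eq_one.1 h2

/-! ### Non-normal cyclic subgroups of order greater than `p` are impossible. -/

section exclude

variable {G : Type*} [Group G] [Finite G] {p : ℕ} [hpF : Fact p.Prime]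

/-- For `u = 1 + p * r`, the power is `1 + p ^ (n + 2) * u` modulo `p ^ (n + 3)`, and `p ∤ u`. The
excluded case is a true exception: `3 ^ 2 ≡ 1` modulo `8`. -/
theorem not_dvd_one_add_pow_sub_one (n : ℕ) (hn : p = 2 → 1 ≤ n) (r : ℤ) :
    ¬ (p : ℤ) ^ (n + 3) ∣ (1 + (p : ℤ) ^ (n + 1) * (1 + p * r)) ^ p - 1 := by
  have hp2 : p.Prime := hpF.out
  have hpZ : Prime (p : ℤ) := Nat.prime_iff_prime_int.1 hp2
  intro hd
  obtain ⟨Y, hY⟩ := ZMod.exists_one_add_mul_pow_prime_eq (R := ℤ) (u := (p : ℤ) ^ (n + 1))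
    (v := (p : ℤ)) hp2 (dvd_pow_self _ (by omega)) (by
      rw [← pow_mul, show (p : ℤ) * p ^ (n + 1) * p = p ^ (n + 3) by ring]
      refine pow_dvd_pow _ ?_
      rcases eq_or_lt_of_le hp2.two_le with h | h
      · have := hn h.symm
        rw [← h]; omega
      · nlinarith) (1 + p * r)
  rw [hY] at hd
  have h1 : (p : ℤ) ^ (n + 2) * p ∣ (p : ℤ) ^ (n + 2) * (1 + p * r + p * Y) := by
    convert hd using 1 <;> ring
  have h2 := (mul_dvd_mul_iff_left (pow_ne_zero (n + 2) hpZ.ne_zero)).1 h1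
  have h3 : (p : ℤ) ∣ 1 := by
    have : (1 : ℤ) = (1 + p * r + p * Y) - p * (r + Y) := by ring
    rw [this]
    exact dvd_sub h2 (dvd_mul_right _ _)
  exact hpZ.not_isUnit (isUnit_of_dvd_one h3)

/-- A group whose quotient by `⟨y ^ p⟩` is modular with non-normal subgroup `⟨y⟩ / ⟨y ^ p⟩` has
two non-conjugate non-normal subgroups. -/
theorem false_of_modular_quotient (hp : IsPGroup p G) (hG : NonNormalConjugate G) {x y : G} {n : ℕ}
    (hy : orderOf y = p ^ 2) (hn : ¬ (Subgroup.zpowers y).Normal) (hpn : p = 2 → 1 ≤ n)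
    (hx : ∀ i : ℤ, x ^ i ∈ Subgroup.zpowers (y ^ p) ↔ (p : ℤ) ^ (n + 2) ∣ i)
    (hxy : ∃ τ ∈ Subgroup.zpowers (y ^ p), y⁻¹ * x * y = x ^ (1 + (p : ℤ) ^ (n + 1)) * τ) :
    False := by
  have hp2 : p.Prime := hpF.out
  have hpZ : Prime (p : ℤ) := Nat.prime_iff_prime_int.1 hp2
  set t := y ^ p with ht
  have hto : orderOf t = p := by
    rw [ht, orderOf_pow, hy, sq, Nat.gcd_mul_left_left, Nat.mul_div_cancel _ hp2.pos]
  have htp : t ^ p = 1 := orderOf_dvd_iff_pow_eq_one.1 hto.dvd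
  have hTc : Subgroup.zpowers t ≤ Subgroup.center G := by
    refine hp.le_center_of_card_eq_prime (hG.normal_of_card_ne hn ?_) ?_
    · rw [Nat.card_zpowers, Nat.card_zpowers, hto, hy, sq]
      nlinarith [hp2.one_lt]
    · rw [Nat.card_zpowers, hto]
  have hcen : ∀ {d : G}, d ∈ Subgroup.zpowers t → ∀ g, Commute d g := fun hd g =>
    (Subgroup.mem_center_iff.1 (hTc hd) g).symm
  -- A generator of a non-normal cyclic subgroup thus has its `p`-th power in `⟨t⟩`. This test shows
  -- that `⟨x⟩`, and later `⟨y * u⟩`, is normal.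
  have hpow : ∀ (g : G) (i : ℤ), (g * y ^ i * g⁻¹) ^ p = t ^ i := by
    intro g i
    have h1 : (g * y ^ i * g⁻¹) ^ p = g * (y ^ i) ^ p * g⁻¹ := (map_pow (MulAut.conj g) _ p).symm
    have h2 : (y ^ i) ^ p = t ^ i := by
      rw [ht, ← zpow_natCast, ← zpow_natCast, ← zpow_mul, ← zpow_mul, mul_comm]
    rw [h1, h2, ← (hcen (zpow_mem (Subgroup.mem_zpowers t) i) g).eq, mul_inv_cancel_right]
  have hnd : ∀ {a b : ℕ}, b < a → ¬ (p : ℤ) ^ a ∣ (p : ℤ) ^ b := by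
    intro a b hab h
    rw [pow_dvd_pow_iff hpZ.ne_zero hpZ.not_isUnit] at h
    omega
  have hxN : (Subgroup.zpowers x).Normal := by
    by_contra hc
    obtain ⟨g, i, hgi⟩ := hG.exists_eq_conj_zpow hn hc
    have h1 := hpow g i
    rw [← hgi] at h1
    have h2 := (hx p).1 (by rw [zpow_natCast, h1]; exact zpow_mem (Subgroup.mem_zpowers t) i)
    exact hnd (a := n + 2) (b := 1) (by omega) (by simpa using h2)
  obtain ⟨s, hs⟩ : ∃ s : ℤ, x ^ s = y⁻¹ * x * y := by
    have := hxN.conj_mem x (Subgroup.mem_zpowers x) y⁻¹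
    rw [inv_inv] at this
    exact this
  have hs1 : (p : ℤ) ^ (n + 2) ∣ s - (1 + (p : ℤ) ^ (n + 1)) := by
    obtain ⟨τ, hτ, h1⟩ := hxy
    rw [← hx, zpow_sub, hs, h1, ← (hcen hτ _).eq, mul_inv_cancel_right]
    exact hτ
  obtain ⟨r, hr⟩ := hs1
  have hsr : s = 1 + (p : ℤ) ^ (n + 1) * (1 + p * r) := by
    rw [sub_eq_iff_eq_add] at hr
    rw [hr]; ring
  have hconj : ∀ (j : ℕ), x * y ^ j = y ^ j * x ^ (s ^ j) := by
    have h1 : ∀ m : ℤ, x ^ m * y = y * x ^ (s * m) := by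
      intro m
      have h2 : y⁻¹ * x ^ m * y = (y⁻¹ * x * y) ^ m := by
        have := map_zpow (MulAut.conj y⁻¹) x m
        simpa using this
      rw [zpow_mul, hs, ← h2]; group
    intro j
    induction j with
    | zero => simp
    | succ j ih =>
      rw [pow_succ, ← mul_assoc, ih, mul_assoc, h1, ← mul_assoc, pow_succ' s]
  have hxt : x ^ (s ^ p) = x := by
    have h1 := hconj p
    rw [← ht, ← (hcen (Subgroup.mem_zpowers t) x).eq] at h1
    exact (mul_left_cancel h1).symm
  -- If `t ∈ ⟨x⟩`, then `|x| = p ^ (n + 3)`, and `y ^ p` being central forces `s ^ p ≡ 1` modulo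
  -- `|x|`, which `not_dvd_one_add_pow_sub_one` forbids. Otherwise `⟨x⟩ ∩ ⟨t⟩ = 1`.
  by_cases htx : t ∈ Subgroup.zpowers x
  · obtain ⟨e, he⟩ := htx
    have he : x ^ e = t := he
    have h1 := (hx e).1 (by rw [he]; exact Subgroup.mem_zpowers t)
    have ho : orderOf x = p ^ (n + 3) := by
      refine orderOf_eq_prime_pow (n := n + 2) ?_ ?_
      · intro h2
        obtain ⟨k, rfl⟩ := h1
        rw [zpow_mul] at he
        have : x ^ ((p : ℤ) ^ (n + 2)) = 1 := by exact_mod_cast h2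
        rw [this, one_zpow] at he
        rw [← he, orderOf_one] at hto
        exact hp2.one_lt.ne hto
      · obtain ⟨k, hk⟩ := (hx ((p : ℤ) ^ (n + 2))).2 dvd_rfl
        have hk : t ^ k = x ^ p ^ (n + 2) := by exact_mod_cast hk
        rw [pow_succ p (n + 2), pow_mul, ← hk, ← zpow_natCast, ← zpow_mul, mul_comm, zpow_mul,
          zpow_natCast, htp, one_zpow]
    have h3 : x ^ (s ^ p - 1) = 1 := by rw [zpow_sub, hxt, zpow_one, mul_inv_cancel]
    rw [← orderOf_dvd_iff_zpow_eq_one, ho, hsr] at h3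
    exact not_dvd_one_add_pow_sub_one n hpn r (by exact_mod_cast h3)
  · have htx' : ∀ i : ℤ, t ^ i ∈ Subgroup.zpowers x → (p : ℤ) ∣ i := by
      intro i hi
      by_contra hpi
      exact htx (Subgroup.zpowers_le.2 hi
        (mem_zpowers_zpow_of_not_dvd (e := 1) hp2 (by rwa [pow_one]) hpi))
    have hx1 : x ^ p ^ (n + 2) = 1 := by
      obtain ⟨k, hk⟩ := (hx ((p : ℤ) ^ (n + 2))).2 dvd_rfl
      have hk : t ^ k = x ^ p ^ (n + 2) := by exact_mod_cast hk
      obtain ⟨k, rfl⟩ := htx' k (hk ▸ pow_mem (Subgroup.mem_zpowers x) _)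
      rw [← hk, zpow_mul, zpow_natCast, htp, one_zpow]
    set z := x ^ p ^ (n + 1) with hz
    have hzT : z ∉ Subgroup.zpowers t := by
      intro h1
      have := (hx ((p : ℤ) ^ (n + 1))).1 (by rw [hz] at h1; exact_mod_cast h1)
      exact hnd (by omega) this
    have hzx : z ∈ Subgroup.zpowers x := pow_mem (Subgroup.mem_zpowers x) _
    have hzp : z ^ p = 1 := by rw [hz, ← pow_mul, ← pow_succ, hx1]
    have hzcx : Commute z x := (Commute.refl x).pow_left _
    have hxs : x * y = y * x * z := by
      have h1 := hconj 1
      rw [pow_one, pow_one] at h1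
      rw [h1, mul_assoc, hsr]
      congr 1
      have h2 : x ^ ((p : ℤ) ^ (n + 2) * r) = 1 := by
        rw [zpow_mul]
        have : x ^ ((p : ℤ) ^ (n + 2)) = 1 := by exact_mod_cast hx1
        rw [this, one_zpow]
      rw [show 1 + (p : ℤ) ^ (n + 1) * (1 + p * r) = 1 + (p : ℤ) ^ (n + 1) + p ^ (n + 2) * r by ring,
        zpow_add, zpow_add, h2, mul_one, zpow_one, hz]
      congr 1
      exact_mod_cast rfl
    have hzcy : Commute z y := by
      have h1 := pow_mul_eq_of_commutator_commute hxs hzcx (p ^ (n + 1))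
      rw [← hz, pow_succ', pow_mul z, hzp, one_pow, mul_one] at h1
      exact h1
    -- A `p`-th root of `z`, so that `(y * u) ^ p = t * z ∉ ⟨t⟩` and `⟨y * u⟩` is normal;
    -- conjugating by `x` then puts `z` in it.
    set u := x ^ p ^ n with hu
    have hup : u ^ p = z := by rw [hu, hz, ← pow_mul, ← pow_succ]
    have huy : u * y = y * u * z ^ p ^ n := pow_mul_eq_of_commutator_commute hxs hzcx (p ^ n)
    have hzu : Commute z u := hzcx.pow_right _
    have hap : (y * u) ^ p = t * z := by
      rw [mul_pow_eq_of_commutator_commute huy (hzcy.pow_left _) (hzu.pow_left _), hup, ← ht]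
      have : (z ^ p ^ n) ^ p.choose 2 = 1 := by
        rcases Nat.eq_zero_or_pos n with rfl | hn0
        · have hp22 : p ≠ 2 := fun h => by have := hpn h; omega
          obtain ⟨e, he⟩ := hp2.dvd_choose_self two_ne_zero (lt_of_le_of_ne hp2.two_le (Ne.symm hp22))
          rw [he, pow_zero, pow_one, pow_mul, hzp, one_pow]
        · obtain ⟨m, rfl⟩ := Nat.exists_eq_succ_of_ne_zero hn0.ne'
          rw [pow_succ', pow_mul z, hzp, one_pow, one_pow]
      rw [this, mul_one]
    have haN : (Subgroup.zpowers (y * u)).Normal := by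
      by_contra hc
      obtain ⟨g, i, hgi⟩ := hG.exists_eq_conj_zpow hn hc
      have h1 := hpow g i
      rw [← hgi, hap] at h1
      apply hzT
      have h2 : z = t⁻¹ * t ^ i := by rw [← h1, inv_mul_cancel_left]
      rw [h2]
      exact mul_mem (inv_mem (Subgroup.mem_zpowers t)) (zpow_mem (Subgroup.mem_zpowers t) i)
    obtain ⟨i, hi⟩ : z ∈ Subgroup.zpowers (y * u) := by
      have h1 := haN.conj_mem _ (Subgroup.mem_zpowers (y * u)) x⁻¹
      have h2 : x⁻¹ * (y * u) * x⁻¹⁻¹ = y * u * z⁻¹ := by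
        have h3 : x⁻¹ * y = y * z⁻¹ * x⁻¹ := by
          rw [inv_mul_eq_iff_eq_mul, ← mul_assoc, ← mul_assoc, hxs,
            mul_inv_cancel_right, mul_inv_cancel_right]
        have h4 : Commute x u := (Commute.refl x).pow_right _
        rw [inv_inv, ← mul_assoc, h3, mul_assoc (y * z⁻¹ * x⁻¹), ← h4.eq, ← mul_assoc,
          inv_mul_cancel_right, mul_assoc, hzu.inv_left.eq, ← mul_assoc]
      rw [h2] at h1
      have h3 := mul_mem (inv_mem (Subgroup.mem_zpowers (y * u))) h1
      rw [inv_mul_cancel_left] at h3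
      exact (Subgroup.inv_mem_iff _).1 h3
    -- As `⟨t⟩` meets `⟨x⟩` trivially, comparing components makes `p` divide `i` and then `i / p`,
    -- so `z = 1`.
    have hi : (y * u) ^ i = z := hi
    have htz : ∀ i : ℤ, (t * z) ^ i = t ^ i * z ^ i :=
      (hcen (Subgroup.mem_zpowers t) z).mul_zpow
    have h1 : t ^ i * z ^ i = 1 := by
      rw [← htz, ← hap, ← zpow_natCast, ← zpow_mul, mul_comm, zpow_mul, hi, zpow_natCast, hzp]
    obtain ⟨j, rfl⟩ := htx' i (by
      rw [mul_eq_one_iff_eq_inv.1 h1]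
      exact inv_mem (zpow_mem hzx i))
    rw [zpow_mul, zpow_natCast, hap, htz] at hi
    obtain ⟨l, rfl⟩ := htx' j (by
      rw [← eq_mul_inv_iff_mul_eq] at hi
      rw [hi]
      exact mul_mem hzx (inv_mem (zpow_mem hzx j)))
    rw [zpow_mul, zpow_mul, zpow_natCast, zpow_natCast, htp, hzp, one_zpow, one_mul] at hi
    exact hzT (hi ▸ one_mem _)

/-- Modulo `⟨h ^ p⟩` the image of `h` has order `p` and stays non-normal, so the quotient is
modular, with `h ^ k` lifting its second generator. -/
theorem false_of_nonNormal_orderOf_sq (hp : IsPGroup p G) (hG : NonNormalConjugate G) {h : G}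
    (ho : orderOf h = p ^ 2) (hn : ¬ (Subgroup.zpowers h).Normal) : False := by
  have hp2 : p.Prime := hpF.out
  have hTn : (Subgroup.zpowers (h ^ p)).Normal := by
    refine hG.normal_of_card_ne hn ?_
    rw [Nat.card_zpowers, Nat.card_zpowers, ho, orderOf_pow, ho, sq, Nat.gcd_mul_left_left,
      Nat.mul_div_cancel _ hp2.pos]
    nlinarith [hp2.one_lt]
  have hTle : Subgroup.zpowers (h ^ p) ≤ Subgroup.zpowers h :=
    Subgroup.zpowers_le.2 (pow_mem (Subgroup.mem_zpowers h) p)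
  set f := QuotientGroup.mk' (Subgroup.zpowers (h ^ p)) with hf
  have hof : orderOf (f h) = p := by
    refine orderOf_eq_prime ?_ ?_
    · rw [← map_pow]
      exact (QuotientGroup.eq_one_iff _).2 (Subgroup.mem_zpowers _)
    · intro h1
      have := (QuotientGroup.eq_one_iff _).1 h1
      rw [mem_zpowers_pow_iff, ho, sq, Nat.gcd_mul_right_right] at this
      exact hp2.one_lt.ne' this
  obtain ⟨X, k, n, hpn, hpk, hX, hXh, -, -⟩ := exists_modular_generators
    (hp.to_quotient (Subgroup.zpowers (h ^ p))) (hG.quotient _) hof (not_normal_zpowers_mk hn _ hTle)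
  obtain ⟨x, rfl⟩ := QuotientGroup.mk'_surjective _ X
  have hpkZ : ¬ (p : ℤ) ∣ (k : ℤ) := by exact_mod_cast hpk
  have hz1 : Subgroup.zpowers (h ^ k) = Subgroup.zpowers h := by
    apply le_antisymm (Subgroup.zpowers_le.2 (pow_mem (Subgroup.mem_zpowers h) k))
    have := mem_zpowers_zpow_of_not_dvd hp2 ho hpkZ
    rw [zpow_natCast] at this
    exact Subgroup.zpowers_le.2 this
  have hyo : orderOf (h ^ k) = p ^ 2 := by
    rw [← Nat.card_zpowers, hz1, Nat.card_zpowers, ho]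
  have hz2 : Subgroup.zpowers ((h ^ k) ^ p) = Subgroup.zpowers (h ^ p) := by
    rw [← pow_mul, mul_comm, pow_mul]
    apply le_antisymm (Subgroup.zpowers_le.2 (pow_mem (Subgroup.mem_zpowers _) k))
    have := mem_zpowers_zpow_of_not_dvd (t := h ^ p) (e := 1) hp2 (by
      rw [orderOf_pow, ho, sq, Nat.gcd_mul_left_left, Nat.mul_div_cancel _ hp2.pos, pow_one]) hpkZ
    rw [zpow_natCast] at this
    exact Subgroup.zpowers_le.2 this
  refine false_of_modular_quotient (x := x) (y := h ^ k) (n := n) hp hG hyo (by rwa [hz1]) hpn ?_ ?_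
  · intro i
    rw [hz2, ← QuotientGroup.eq_one_iff, ← QuotientGroup.mk'_apply, map_zpow,
      ← orderOf_dvd_iff_zpow_eq_one, hX]
    push_cast
    rfl
  · rw [hz2]
    refine ⟨(x ^ (1 + (p : ℤ) ^ (n + 1)))⁻¹ * ((h ^ k)⁻¹ * x * h ^ k), ?_, by group⟩
    rw [← QuotientGroup.eq_one_iff, ← QuotientGroup.mk'_apply, map_mul, map_inv, inv_mul_eq_one,
      map_mul, map_mul, map_inv, map_pow, map_zpow, mul_assoc, hXh, inv_mul_cancel_left]
    exact_mod_cast rfl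

/-- For larger order, factoring out the normal subgroup `⟨h ^ p ^ 2⟩` reduces to order `p ^ 2`. -/
theorem orderOf_eq_prime_of_nonNormal (hp : IsPGroup p G) (hG : NonNormalConjugate G) {h : G}
    (hn : ¬ (Subgroup.zpowers h).Normal) : orderOf h = p := by
  have hp2 : p.Prime := hpF.out
  obtain ⟨m, hm⟩ := IsPGroup.iff_orderOf.1 hp h
  rcases m with _ | _ | m
  · rw [pow_zero, orderOf_eq_one_iff] at hm
    rw [hm, Subgroup.zpowers_one_eq_bot] at hn
    exact (hn inferInstance).elim
  · simpa using hm
  exfalso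
  have hm : orderOf h = p ^ (m + 2) := hm
  have ho2 : orderOf (h ^ p ^ 2) = p ^ m := by
    rw [orderOf_pow, hm, pow_add, Nat.gcd_mul_left_left, Nat.mul_div_cancel _ (pow_pos hp2.pos 2)]
  have hTn : (Subgroup.zpowers (h ^ p ^ 2)).Normal := by
    refine hG.normal_of_card_ne hn ?_
    rw [Nat.card_zpowers, Nat.card_zpowers, ho2, hm]
    exact (Nat.pow_lt_pow_right hp2.one_lt (by omega)).ne
  have hTle : Subgroup.zpowers (h ^ p ^ 2) ≤ Subgroup.zpowers h :=
    Subgroup.zpowers_le.2 (pow_mem (Subgroup.mem_zpowers h) _)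
  refine false_of_nonNormal_orderOf_sq (hp.to_quotient (Subgroup.zpowers (h ^ p ^ 2)))
    (hG.quotient _) (h := QuotientGroup.mk' _ h) ?_ (not_normal_zpowers_mk hn _ hTle)
  refine orderOf_eq_prime_pow (n := 1) ?_ ?_
  · rw [pow_one, ← map_pow]
    intro h1
    have h2 := orderOf_dvd_of_mem_zpowers ((QuotientGroup.eq_one_iff _).1 h1)
    rw [ho2, orderOf_pow, hm, pow_succ, Nat.gcd_mul_left_left, Nat.mul_div_cancel _ hp2.pos,
      Nat.pow_dvd_pow_iff_le_right hp2.one_lt] at h2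
    omega
  · rw [← map_pow]
    exact (QuotientGroup.eq_one_iff _).2 (Subgroup.mem_zpowers _)

end exclude

/-! ### Recognising the presented group `M(p^n)`. -/

theorem exists_eq_pow_mul_pow {M : Type*} [Group M] {X Y : M} {a b s : ℕ} (ha : 0 < a) (hb : 0 < b)
    (hX : X ^ a = 1) (hY : Y ^ b = 1) (hXY : X * Y = Y * X ^ s)
    (hgen : Subgroup.closure {X, Y} = ⊤) (w : M) : ∃ i j : ℕ, w = Y ^ j * X ^ i := by
  have h1 : ∀ m : ℕ, X ^ m * Y = Y * X ^ (s * m) := by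
    intro m
    induction m with
    | zero => simp
    | succ m ih =>
      rw [pow_succ, mul_assoc, hXY, ← mul_assoc, ih, mul_assoc, ← pow_add, mul_add, mul_one]
  have h2 : ∀ j : ℕ, X * Y ^ j = Y ^ j * X ^ (s ^ j) := by
    intro j
    induction j with
    | zero => simp
    | succ j ih =>
      rw [pow_succ, ← mul_assoc, ih, mul_assoc, h1, ← mul_assoc, pow_succ' s]
  have hXl : ∀ m w : M, m = X → (∃ i j : ℕ, w = Y ^ j * X ^ i) →
      ∃ i j : ℕ, m * w = Y ^ j * X ^ i := by
    rintro _ _ rfl ⟨i, j, rfl⟩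
    exact ⟨s ^ j + i, j, by rw [← mul_assoc, h2, mul_assoc, ← pow_add]⟩
  have hYl : ∀ m w : M, m = Y → (∃ i j : ℕ, w = Y ^ j * X ^ i) →
      ∃ i j : ℕ, m * w = Y ^ j * X ^ i := by
    rintro _ _ rfl ⟨i, j, rfl⟩
    exact ⟨i, j + 1, by rw [← mul_assoc, pow_succ']⟩
  have hpow : ∀ (m : M), (∀ w : M, (∃ i j : ℕ, w = Y ^ j * X ^ i) →
      ∃ i j : ℕ, m * w = Y ^ j * X ^ i) → ∀ (k : ℕ) (w : M), (∃ i j : ℕ, w = Y ^ j * X ^ i) →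
      ∃ i j : ℕ, m ^ k * w = Y ^ j * X ^ i := by
    intro m hm k
    induction k with
    | zero => intro w hw; simpa using hw
    | succ k ih => intro w hw; rw [pow_succ, mul_assoc]; exact ih _ (hm w hw)
  have hinv : ∀ (m : M) (c : ℕ), 0 < c → m ^ c = 1 → m⁻¹ = m ^ (c - 1) := by
    intro m c hc hm
    rw [inv_eq_iff_mul_eq_one, ← pow_succ', Nat.sub_add_cancel hc, hm]
  have hw : w ∈ Subgroup.closure {X, Y} := hgen ▸ Subgroup.mem_top w
  induction hw using Subgroup.closure_induction_left with
  | one => exact ⟨0, 0, by simp⟩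
  | mul_left x hx y _ ih =>
    rcases hx with hx | hx
    · exact hXl x y hx ih
    · exact hYl x y hx ih
  | inv_mul_cancel x hx y _ ih =>
    rcases hx with hx | hx
    · obtain rfl : x = X := hx
      rw [hinv _ a ha hX]
      exact hpow _ (fun w => hXl _ w rfl) _ _ ih
    · obtain rfl : x = Y := hx
      rw [hinv _ b hb hY]
      exact hpow _ (fun w => hYl _ w rfl) _ _ ih

section presented

variable (p n : ℕ)

theorem modular_x_pow :
    (PresentedGroup.of 0 : ModularMaxCyclicGroup p n) ^ p ^ (n - 1) = 1 :=
  PresentedGroup.one_of_mem (rels := modularRels p n) (x := FreeGroup.of 0 ^ p ^ (n - 1))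
    (Or.inl rfl)

theorem modular_y_pow : (PresentedGroup.of 1 : ModularMaxCyclicGroup p n) ^ p = 1 :=
  PresentedGroup.one_of_mem (rels := modularRels p n) (x := FreeGroup.of 1 ^ p)
    (Or.inr (Or.inl rfl))

theorem modular_x_mul_y :
    (PresentedGroup.of 0 : ModularMaxCyclicGroup p n) * PresentedGroup.of 1 =
      PresentedGroup.of 1 * PresentedGroup.of 0 ^ (1 + p ^ (n - 2)) := by
  have h : (PresentedGroup.of 1 : ModularMaxCyclicGroup p n)⁻¹ * PresentedGroup.of 0 *
      PresentedGroup.of 1 * (PresentedGroup.of 0 ^ (1 + p ^ (n - 2)))⁻¹ = 1 :=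
    PresentedGroup.one_of_mem (rels := modularRels p n)
      (x := (FreeGroup.of 1)⁻¹ * FreeGroup.of 0 * FreeGroup.of 1 *
        (FreeGroup.of 0 ^ (1 + p ^ (n - 2)))⁻¹) (Or.inr (Or.inr rfl))
  rw [mul_inv_eq_one, mul_assoc, inv_mul_eq_iff_eq_mul] at h
  exact h

theorem modular_closure : Subgroup.closure
    {(PresentedGroup.of 0 : ModularMaxCyclicGroup p n), PresentedGroup.of 1} = ⊤ := by
  rw [← PresentedGroup.closure_range_of (modularRels p n)]
  congr 1
  ext w
  simp [Fin.exists_fin_two, eq_comm]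

end presented

/-- The relators hold for `x`, `y`, giving a surjection onto `G`. It is injective since the
presented group consists of words `Y ^ j * X ^ i`, while `⟨x⟩ ∩ ⟨y⟩ = 1` and `x`, `y` have the full
orders. -/
theorem nonempty_mulEquiv_modular {G : Type*} [Group G] {p n : ℕ} (hp : p.Prime) {x y : G}
    (hx : orderOf x = p ^ (n + 2)) (hy : orderOf y = p) (hyx : y ∉ Subgroup.zpowers x)
    (hxy : x * y = y * x ^ (1 + p ^ (n + 1))) (hrep : ∀ w : G, ∃ i j : ℤ, w = y ^ j * x ^ i) :
    Nonempty (G ≃* ModularMaxCyclicGroup p (n + 3)) := by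
  have hxp : x ^ p ^ (n + 2) = 1 := orderOf_dvd_iff_pow_eq_one.1 hx.dvd
  have hyp : y ^ p = 1 := orderOf_dvd_iff_pow_eq_one.1 hy.dvd
  have hrel : ∀ r ∈ modularRels p (n + 3), FreeGroup.lift ![x, y] r = 1 := by
    rintro r (rfl | rfl | rfl)
    · simpa using hxp
    · simpa using hyp
    · simp only [map_mul, map_inv, map_pow, FreeGroup.lift_apply_of]
      show y⁻¹ * x * y * (x ^ (1 + p ^ (n + 1)))⁻¹ = 1
      rw [mul_inv_eq_one, mul_assoc, inv_mul_eq_iff_eq_mul, hxy]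
  let φ : ModularMaxCyclicGroup p (n + 3) →* G := PresentedGroup.toGroup hrel
  have h0 : φ (PresentedGroup.of 0) = x := PresentedGroup.toGroup.of hrel
  have h1 : φ (PresentedGroup.of 1) = y := PresentedGroup.toGroup.of hrel
  refine ⟨(MulEquiv.ofBijective φ ⟨?_, ?_⟩).symm⟩
  · rw [injective_iff_map_eq_one]
    intro w hw
    obtain ⟨i, j, rfl⟩ := exists_eq_pow_mul_pow (pow_pos hp.pos _) hp.pos
      (modular_x_pow p (n + 3)) (modular_y_pow p (n + 3)) (modular_x_mul_y p (n + 3))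
      (modular_closure p (n + 3)) w
    rw [map_mul, map_pow, map_pow, h0, h1] at hw
    have hj : p ∣ j := by
      by_contra hj
      apply hyx
      have h2 := mem_zpowers_zpow_of_not_dvd (t := y) (e := 1) hp (by rwa [pow_one])
        (i := (j : ℤ)) (by exact_mod_cast hj)
      rw [zpow_natCast, mul_eq_one_iff_eq_inv.1 hw] at h2
      exact Subgroup.zpowers_le.2 (inv_mem (pow_mem (Subgroup.mem_zpowers x) i)) h2
    obtain ⟨j, rfl⟩ := hj
    rw [pow_mul, hyp, one_pow, one_mul, ← orderOf_dvd_iff_pow_eq_one, hx] at hw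
    obtain ⟨i, rfl⟩ := hw
    have h2 := modular_x_pow p (n + 3)
    rw [show n + 3 - 1 = n + 2 by omega] at h2
    rw [pow_mul, pow_mul, modular_y_pow, h2, one_pow, one_pow, one_mul]
  · intro w
    obtain ⟨i, j, rfl⟩ := hrep w
    exact ⟨PresentedGroup.of 1 ^ j * PresentedGroup.of 0 ^ i, by
      rw [map_mul, map_zpow, map_zpow, h0, h1]⟩

theorem isModularMaxCyclic_of_isPGroup {G : Type*} [Group G] [Finite G] {p : ℕ} [hpF : Fact p.Prime]
    (hp : IsPGroup p G) (hG : NonNormalConjugate G) (hN : ∃ H : Subgroup G, ¬ H.Normal) :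
    IsModularMaxCyclic G := by
  have hp2 : p.Prime := hpF.out
  obtain ⟨H, hH⟩ := hN
  obtain ⟨h, -, hn⟩ := exists_zpowers_not_normal hH
  have ho := orderOf_eq_prime_of_nonNormal hp hG hn
  obtain ⟨x, k, n, hpn, hpk, hx, hxh, hhx, hrep⟩ := exists_modular_generators hp hG ho hn
  have hk := mem_zpowers_zpow_of_not_dvd (t := h) (e := 1) hp2 (by rwa [pow_one])
    (i := (k : ℤ)) (by exact_mod_cast hpk)
  rw [zpow_natCast] at hk
  refine ⟨p, n + 3, hp2, ?_, nonempty_mulEquiv_modular (y := h ^ k) hp2 hx ?_ ?_ hxh ?_⟩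
  · rcases eq_or_lt_of_le hp2.two_le with h | h
    · right
      have := hpn h.symm
      omega
    · left
      omega
  · refine orderOf_eq_prime ?_ ?_
    · rw [← pow_mul, mul_comm, pow_mul, ← ho, pow_orderOf_eq_one, one_pow]
    · intro h1
      rw [h1, Subgroup.zpowers_one_eq_bot, Subgroup.mem_bot] at hk
      rw [hk] at hhx
      exact hhx (one_mem _)
  · exact fun h1 => hhx (Subgroup.zpowers_le.2 h1 hk)
  · intro w
    obtain ⟨i, j, rfl⟩ := hrep w
    obtain ⟨l, hl⟩ := hk
    have hl : (h ^ k) ^ l = h := hl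
    exact ⟨i, l * j, by rw [zpow_mul, hl]⟩

/-! ### Reduction to a non-normal Sylow subgroup or a `p`-group. -/

section reduction

variable {G : Type*} [Group G] [Finite G]

theorem isCyclicSemidirect_of_sylow (hG : NonNormalConjugate G) {q : ℕ} [hqF : Fact q.Prime]
    (P : Sylow q G) (hP : ¬ (P : Subgroup G).Normal) : IsCyclicSemidirect G := by
  have hq : q.Prime := hqF.out
  obtain ⟨h, hhP, hh⟩ := exists_zpowers_not_normal hP
  have hPz : Subgroup.zpowers h = P := by
    by_contra hne
    exact hh (hG.normal_of_lt hP (lt_of_le_of_ne (Subgroup.zpowers_le.2 hhP) hne))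
  have hcyc : IsCyclic (P : Subgroup G) := by rw [← hPz]; infer_instance
  have hself : Subgroup.normalizer (P : Set G) = P := by
    by_contra hne
    exact hP (P.normal_of_normalizer_normal
      (hG.normal_of_gt hP (lt_of_le_of_ne Subgroup.le_normalizer (Ne.symm hne))))
  have hidx : (P : Subgroup G).index ≠ 1 := by
    intro h1
    rw [Subgroup.index_eq_one] at h1
    exact hP (h1 ▸ inferInstance)
  set r := (P : Subgroup G).index.minFac with hr
  have hrp : r.Prime := Nat.minFac_prime hidx
  have : Fact r.Prime := ⟨hrp⟩
  have hri : r ∣ (P : Subgroup G).index := Nat.minFac_dvd _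
  have hcop := P.card_coprime_index
  have hrP : Nat.Coprime r (Nat.card P) := (hcop.coprime_dvd_right hri).symm
  obtain ⟨x, hx⟩ := exists_prime_orderOf_dvd_card' (G := G) r
    (hri.trans (Subgroup.index_dvd_card _))
  set N := Subgroup.zpowers x with hNd
  have hNc : Nat.card N = r := by rw [hNd, Nat.card_zpowers, hx]
  have hNn : N.Normal := by
    refine hG.normal_of_card_ne hP fun h1 => ?_
    rw [hNc] at h1
    have h2 : Nat.Coprime r (Nat.card (P : Subgroup G)) := hrP
    rw [← h1, Nat.coprime_self] at h2
    exact hrp.one_lt.ne' h2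
  have hdis : N ⊓ (P : Subgroup G) = ⊥ := 
    (Subgroup.disjoint_of_coprime_natCard (by rw [hNc]; exact hrP)).eq_bot
  have hlt : (P : Subgroup G) < N ⊔ P := by
    refine lt_of_le_of_ne le_sup_right fun he => ?_
    have h1 : N ≤ P := by rw [he]; exact le_sup_left
    rw [inf_eq_left.2 h1] at hdis
    rw [hdis, Subgroup.card_bot] at hNc
    exact hrp.one_lt.ne hNc
  have hMn := hG.normal_of_gt hP hlt
  -- Frattini argument for the normal subgroup `NP`, with `P` its own normalizer.
  have htop : N ⊔ (P : Subgroup G) = ⊤ := by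
    have h1 := Sylow.normalizer_sup_eq_top' P (N := N ⊔ P) le_sup_right
    rwa [hself, sup_eq_right.2 le_sup_right] at h1
  have hcompl : N.IsComplement' P := by
    refine Subgroup.isComplement'_of_disjoint_and_mul_eq_univ (disjoint_iff.2 hdis) ?_
    rw [← Subgroup.normal_mul, htop, Subgroup.coe_top]
  have hcard : Nat.card (Sylow q G) = r := by
    rw [P.card_eq_index_normalizer, hself, hcompl.index_eq_card, hNc]
  have hmod : q ∣ r - 1 := by
    have h1 := card_sylow_modEq_one q G
    rw [hcard] at h1
    exact (Nat.modEq_iff_dvd' hrp.one_lt.le).1 h1.symm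
  obtain ⟨n, hn⟩ := IsPGroup.iff_card.1 P.isPGroup'
  have hbot : (P : Subgroup G) ≠ ⊥ := fun h1 => hP (h1 ▸ inferInstance)
  have hn1 : 1 ≤ n := by
    rcases Nat.eq_zero_or_pos n with rfl | h1
    · exact absurd (Subgroup.card_eq_one.1 (by simpa using hn)) hbot
    · exact h1
  refine ⟨r, q, n, hrp, hq, hmod, hn1, N, P, hNn, hcompl, ?_, ?_, ?_⟩
  · exact ⟨mulEquivOfCyclicCardEq (by simp [hNc])⟩
  · exact ⟨mulEquivOfCyclicCardEq (by simpa using hn)⟩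
  -- Being proper in `P`, `Φ(P)` is normal in `G`, so `[N, Φ(P)] ≤ N ∩ P = 1`.
  · have hfr : frattini (P : Subgroup G) ≠ ⊤ := by
      intro h1
      have h2 : (⊥ : Subgroup (P : Subgroup G)) = ⊤ :=
        frattini_nongenerating (by rw [h1, bot_sup_eq])
      have h3 : Nat.card (P : Subgroup G) = 1 := by
        rw [← Subgroup.card_top, ← h2, Subgroup.card_bot]
      exact hbot (Subgroup.card_eq_one.1 h3)
    have hle : (frattini (P : Subgroup G)).map (P : Subgroup G).subtype ≤ P :=
      Subgroup.map_subtype_le _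
    have hΦ : ((frattini (P : Subgroup G)).map (P : Subgroup G).subtype).Normal := by
      refine hG.normal_of_lt hP (lt_of_le_of_ne hle fun he => hfr ?_)
      apply Subgroup.map_injective (P : Subgroup G).subtype_injective
      rw [he, ← MonoidHom.range_eq_map, Subgroup.range_subtype]
    rw [eq_bot_iff, ← hdis]
    exact (Subgroup.commutator_le_inf N _).trans (inf_le_inf_left N hle)

/-- Otherwise `⟨h⟩` is generated by two proper subgroups of coprime orders, both normal. -/
theorem exists_prime_pow_orderOf_of_nonNormal (hG : NonNormalConjugate G) {h : G}
    (hn : ¬ (Subgroup.zpowers h).Normal) : ∃ q e : ℕ, q.Prime ∧ orderOf h = q ^ e := by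
  have h1 : orderOf h ≠ 1 := by
    intro h1
    rw [orderOf_eq_one_iff] at h1
    rw [h1, Subgroup.zpowers_one_eq_bot] at hn
    exact hn inferInstance
  have hq := Nat.minFac_prime h1
  set q := (orderOf h).minFac with hqd
  obtain ⟨e, m, hqm, ho⟩ := Nat.exists_eq_pow_mul_and_not_dvd (orderOf_pos h).ne' q hq.ne_one
  refine ⟨q, e, hq, ?_⟩
  by_contra hne
  have hm0 : m ≠ 0 := by rintro rfl; exact hqm (dvd_zero q)
  have hm1 : m ≠ 1 := by rintro rfl; exact hne (by rw [ho, mul_one])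
  have he0 : e ≠ 0 := by
    rintro rfl
    have := Nat.minFac_dvd (orderOf h)
    rw [← hqd, ho, pow_zero, one_mul] at this
    exact hqm this
  have hqe : 1 < q ^ e := Nat.one_lt_pow he0 hq.one_lt
  have hcop : Nat.Coprime (q ^ e) m := (Nat.Prime.coprime_iff_not_dvd hq |>.2 hqm).pow_left e
  have hN1 : (Subgroup.zpowers (h ^ q ^ e)).Normal := by
    refine hG.normal_of_card_ne hn ?_
    rw [Nat.card_zpowers, Nat.card_zpowers, orderOf_pow, ho, Nat.gcd_mul_right_left,
      Nat.mul_div_cancel_left _ (by omega)]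
    have : 0 < m := by omega
    nlinarith
  have hN2 : (Subgroup.zpowers (h ^ m)).Normal := by
    refine hG.normal_of_card_ne hn ?_
    rw [Nat.card_zpowers, Nat.card_zpowers, orderOf_pow, ho, Nat.gcd_mul_left_left,
      Nat.mul_div_cancel _ (by omega)]
    have : 1 < m := by omega
    nlinarith
  apply hn
  have hsup : Subgroup.zpowers h = Subgroup.zpowers (h ^ q ^ e) ⊔ Subgroup.zpowers (h ^ m) := by
    apply le_antisymm
    · rw [Subgroup.zpowers_le]
      obtain ⟨u, v, huv⟩ := Nat.isCoprime_iff_coprime.2 hcop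
      have h2 : h = (h ^ q ^ e) ^ u * (h ^ m) ^ v := by
        rw [← zpow_natCast, ← zpow_natCast, ← zpow_mul, ← zpow_mul, ← zpow_add, mul_comm _ u,
          mul_comm _ v, huv, zpow_one]
      have h3 : (h ^ q ^ e) ^ u * (h ^ m) ^ v ∈
          Subgroup.zpowers (h ^ q ^ e) ⊔ Subgroup.zpowers (h ^ m) :=
        Subgroup.mul_mem_sup (zpow_mem (Subgroup.mem_zpowers _) u)
          (zpow_mem (Subgroup.mem_zpowers _) v)
      rwa [← h2] at h3
    · exact sup_le (Subgroup.zpowers_le.2 (pow_mem (Subgroup.mem_zpowers h) _))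
        (Subgroup.zpowers_le.2 (pow_mem (Subgroup.mem_zpowers h) _))
  rw [hsup]
  infer_instance

/-- A second prime dividing `|G|` supplies a normal `⟨x⟩` of that order; `⟨h⟩⟨x⟩` is normal, and
meeting it with the normal Sylow subgroup above `⟨h⟩` returns `⟨h⟩`. -/
theorem isPGroup_of_sylow_normal (hG : NonNormalConjugate G) (hN : ∃ H : Subgroup G, ¬ H.Normal)
    (hS : ∀ (q : ℕ) (_ : Fact q.Prime) (P : Sylow q G), (P : Subgroup G).Normal) :
    ∃ p : ℕ, p.Prime ∧ IsPGroup p G := by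
  obtain ⟨H, hH⟩ := hN
  obtain ⟨h, -, hn⟩ := exists_zpowers_not_normal hH
  obtain ⟨q, e, hq, ho⟩ := exists_prime_pow_orderOf_of_nonNormal hG hn
  have hqF : Fact q.Prime := ⟨hq⟩
  refine ⟨q, hq, IsPGroup.of_card (Nat.eq_prime_pow_of_unique_prime_dvd Nat.card_pos.ne' ?_)⟩
  intro r hr hrd
  by_contra hrq
  have : Fact r.Prime := ⟨hr⟩
  obtain ⟨x, hx⟩ := exists_prime_orderOf_dvd_card' (G := G) r hrd
  have hcop : Nat.Coprime r q := (Nat.coprime_primes hr hq).2 hrq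
  have hRn : (Subgroup.zpowers x).Normal := by
    refine hG.normal_of_card_ne hn ?_
    rw [Nat.card_zpowers, Nat.card_zpowers, hx, ho]
    intro h1
    have h2 := hcop.pow_right e
    rw [← h1, Nat.coprime_self] at h2
    exact hr.one_lt.ne' h2
  have hHp : IsPGroup q (Subgroup.zpowers h) := IsPGroup.of_card (by rw [Nat.card_zpowers, ho])
  obtain ⟨Q, hQ⟩ := hHp.exists_le_sylow
  have hQn := hS q hqF Q
  have hdis : Subgroup.zpowers x ⊓ (Q : Subgroup G) = ⊥ := by
    refine (Subgroup.disjoint_of_coprime_natCard ?_).eq_bot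
    obtain ⟨k, hk⟩ := IsPGroup.iff_card.1 Q.isPGroup'
    rw [Nat.card_zpowers, hx, hk]
    exact hcop.pow_right k
  have hlt : Subgroup.zpowers h < Subgroup.zpowers h ⊔ Subgroup.zpowers x := by
    refine lt_of_le_of_ne le_sup_left fun he => ?_
    have h1 : Subgroup.zpowers x ≤ Q := by
      refine le_trans ?_ hQ
      rw [he]; exact le_sup_right
    rw [inf_eq_left.2 h1, Subgroup.zpowers_eq_bot] at hdis
    rw [hdis, orderOf_one] at hx
    exact hr.one_lt.ne hx
  have hMn := hG.normal_of_gt hn hlt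
  apply hn
  have heq : Subgroup.zpowers h = (Subgroup.zpowers h ⊔ Subgroup.zpowers x) ⊓ Q := by
    apply le_antisymm (le_inf le_sup_left hQ)
    rintro w ⟨hw1, hw2⟩
    have hw1 : w ∈ ((Subgroup.zpowers h ⊔ Subgroup.zpowers x : Subgroup G) : Set G) := hw1
    rw [Subgroup.mul_normal] at hw1
    obtain ⟨a, ha, b, hb, rfl⟩ := hw1
    have hbQ : b ∈ (Q : Subgroup G) := by
      have := mul_mem (inv_mem (hQ ha)) hw2
      simpa using this
    have hb1 : b ∈ Subgroup.zpowers x ⊓ (Q : Subgroup G) := ⟨hb, hbQ⟩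
    rw [hdis, Subgroup.mem_bot] at hb1
    simpa [hb1] using ha
  rw [heq]
  infer_instance

theorem isCyclicSemidirect_or_isModularMaxCyclic (hG : NonNormalConjugate G)
    (hN : ∃ H : Subgroup G, ¬ H.Normal) : IsCyclicSemidirect G ∨ IsModularMaxCyclic G := by
  by_cases hS : ∀ (q : ℕ) (_ : Fact q.Prime) (P : Sylow q G), (P : Subgroup G).Normal
  · right
    obtain ⟨p, hp, hpG⟩ := isPGroup_of_sylow_normal hG hN hS
    have : Fact p.Prime := ⟨hp⟩
    exact isModularMaxCyclic_of_isPGroup hpG hG hN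
  · left
    push Not at hS
    obtain ⟨q, hq, P, hP⟩ := hS
    exact isCyclicSemidirect_of_sylow hG P hP

end reduction

/-! ### Non-permuting pairs, and the degrees in type (2). -/

section csd

variable {G : Type*} [Group G]

/-- The pairs of cyclic subgroups of `H` and of `G` which do not permute. -/
def nonPermutingPairs (H : Subgroup G) : Set (Subgroup G × Subgroup G) :=
  {x | x.1 ∈ cyclicSubgroups H ∧ x.2 ∈ cyclicSubgroups (⊤ : Subgroup G) ∧
    (x.1 : Set G) * (x.2 : Set G) ≠ (x.2 : Set G) * (x.1 : Set G)}

theorem bot_mem_cyclicSubgroups (H : Subgroup G) : ⊥ ∈ cyclicSubgroups H :=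
  ⟨bot_le, inferInstance⟩

theorem ncard_cyclicSubgroups_pos [Finite G] (H : Subgroup G) : 0 < (cyclicSubgroups H).ncard :=
  (Set.ncard_pos (Set.toFinite _)).2 ⟨⊥, bot_mem_cyclicSubgroups H⟩

theorem csd_eq_one_sub [Finite G] (H : Subgroup G) :
    csd H = 1 - ((nonPermutingPairs H).ncard : ℚ) /
      (((cyclicSubgroups H).ncard : ℚ) * ((cyclicSubgroups (⊤ : Subgroup G)).ncard : ℚ)) := by
  have h1 : (0 : ℚ) < (cyclicSubgroups H).ncard := by exact_mod_cast ncard_cyclicSubgroups_pos H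
  have h2 : (0 : ℚ) < (cyclicSubgroups (⊤ : Subgroup G)).ncard := by
    exact_mod_cast ncard_cyclicSubgroups_pos ⊤
  set S := {x : Subgroup G × Subgroup G |
      x.1 ∈ cyclicSubgroups H ∧ x.2 ∈ cyclicSubgroups (⊤ : Subgroup G) ∧
        (x.1 : Set G) * (x.2 : Set G) = (x.2 : Set G) * (x.1 : Set G)} with hS
  have hU : S ∪ nonPermutingPairs H = cyclicSubgroups H ×ˢ cyclicSubgroups (⊤ : Subgroup G) := by
    ext x
    simp only [hS, nonPermutingPairs, Set.mem_union, Set.mem_ofPred_eq, Set.mem_prod]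
    tauto
  have hd : Disjoint S (nonPermutingPairs H) := by
    rw [Set.disjoint_left]
    rintro x ⟨-, -, hx⟩ ⟨-, -, hx'⟩
    exact hx' hx
  have h3 := Set.ncard_union_eq hd (Set.toFinite _) (Set.toFinite _)
  rw [hU, Set.ncard_prod] at h3
  have h4 : ((cyclicSubgroups H).ncard : ℚ) * (cyclicSubgroups (⊤ : Subgroup G)).ncard =
      S.ncard + (nonPermutingPairs H).ncard := by exact_mod_cast h3
  rw [csd, ← hS, eq_sub_iff_add_eq, ← add_div, ← h4, div_self (mul_pos h1 h2).ne']

theorem mul_comm_of_normal_left {A : Subgroup G} (hA : A.Normal) (B : Subgroup G) :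
    (A : Set G) * (B : Set G) = (B : Set G) * (A : Set G) :=
  (Subgroup.set_mul_normal_comm (B : Set G) A).symm

theorem not_normal_of_mem_nonPermutingPairs {H : Subgroup G} {x : Subgroup G × Subgroup G}
    (hx : x ∈ nonPermutingPairs H) : ¬ x.1.Normal ∧ ¬ x.2.Normal :=
  ⟨fun h => hx.2.2 (mul_comm_of_normal_left h _),
    fun h => hx.2.2 (mul_comm_of_normal_left h _).symm⟩

/-- Since `g * b * g⁻¹ = ⁅g, b⁆ * b`, a cyclic subgroup commutes elementwise with its conjugates, so
no pair fails to permute. -/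
theorem numRelCsd_eq_one_of_commutator_central [Finite G] (hG : NonNormalConjugate G)
    (hc : ∀ a b c : G, Commute ⁅a, b⁆ c) : numRelCsd G = 1 := by
  have key : ∀ H : Subgroup G, csd H = 1 := by
    intro H
    have hempty : nonPermutingPairs H = ∅ := by
      rw [Set.eq_empty_iff_forall_notMem]
      rintro ⟨A, B⟩ hx
      obtain ⟨hA, hB⟩ := not_normal_of_mem_nonPermutingPairs hx
      obtain ⟨⟨-, hcyc⟩, -, hne⟩ := hx
      obtain ⟨g, rfl⟩ := hG A B hA hB
      have hcyc : IsCyclic A := hcyc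
      apply hne
      have hcomm : ∀ a ∈ A, ∀ b ∈ A.map (MulAut.conj g).toMonoidHom, a * b = b * a := by
        rintro a ha _ ⟨b, hb, rfl⟩
        show Commute a (g * b * g⁻¹)
        have h1 : g * b * g⁻¹ = ⁅g, b⁆ * b := by rw [commutatorElement_def, inv_mul_cancel_right]
        have h2 : Commute a b := by
          have : IsMulCommutative A := inferInstance
          exact congrArg Subtype.val (mul_comm' (⟨a, ha⟩ : A) ⟨b, hb⟩)
        rw [h1]
        exact (hc g b a).symm.mul_right h2
      ext w
      constructor
      · rintro ⟨a, ha, b, hb, rfl⟩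
        exact ⟨b, hb, a, ha, (hcomm a ha b hb).symm⟩
      · rintro ⟨b, hb, a, ha, rfl⟩
        exact ⟨a, ha, b, hb, hcomm a ha b hb⟩
    rw [csd_eq_one_sub, hempty]
    simp
  have : (Set.range fun H : Subgroup G => csd H) = {1} := by
    ext v
    simp [key]
  rw [numRelCsd, this, Set.ncard_singleton]

end csd

theorem modular_commutator_central {p n : ℕ} (hn : 3 ≤ n) (a b c : ModularMaxCyclicGroup p n)
    (hp : p.Prime) : Commute ⁅a, b⁆ c := by
  set X : ModularMaxCyclicGroup p n := PresentedGroup.of 0 with hX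
  set Y : ModularMaxCyclicGroup p n := PresentedGroup.of 1 with hY
  have hXp : X ^ p ^ (n - 1) = 1 := modular_x_pow p n
  have hYp : Y ^ p = 1 := modular_y_pow p n
  have hXY : X * Y = Y * X ^ (1 + p ^ (n - 2)) := modular_x_mul_y p n
  have hrep := exists_eq_pow_mul_pow (pow_pos hp.pos _) hp.pos hXp hYp hXY (modular_closure p n)
  set Z := X ^ p ^ (n - 2) with hZ
  have hZp : Z ^ p = 1 := by
    rw [hZ, ← pow_mul, ← pow_succ, show n - 2 + 1 = n - 1 by omega, hXp]
  have hZX : Commute Z X := (Commute.refl X).pow_left _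
  have hXY' : X * Y = Y * X * Z := by rw [hXY, pow_add, pow_one, ← mul_assoc]
  -- Moving `Y` past `Z` costs `Z ^ p ^ (n - 2)`, which is trivial because `3 ≤ n`.
  have hZY : Commute Z Y := by
    have h1 := pow_mul_eq_of_commutator_commute hXY' hZX (p ^ (n - 2))
    rw [← hZ, show n - 2 = (n - 3) + 1 by omega, pow_succ', pow_mul Z, hZp, one_pow, mul_one] at h1
    exact h1
  have hZc : Z ∈ Subgroup.center (ModularMaxCyclicGroup p n) := by
    rw [Subgroup.mem_center_iff]
    intro w
    obtain ⟨i, j, rfl⟩ := hrep w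
    exact ((hZY.pow_right j).mul_right (hZX.pow_right i)).eq.symm
  have hN := normal_zpowers_of_mem_center hZc
  have hab : ⁅a, b⁆ ∈ Subgroup.zpowers Z := by
    rw [← QuotientGroup.ker_mk' (Subgroup.zpowers Z), MonoidHom.mem_ker, map_commutatorElement,
      commutatorElement_eq_one_iff_commute]
    set f := QuotientGroup.mk' (Subgroup.zpowers Z)
    have hfZ : f Z = 1 := (QuotientGroup.eq_one_iff Z).2 (Subgroup.mem_zpowers Z)
    have hf : Commute (f X) (f Y) := by
      show f X * f Y = f Y * f X
      rw [← map_mul, ← map_mul, hXY', map_mul, hfZ, mul_one]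
    obtain ⟨i, j, rfl⟩ := hrep a
    obtain ⟨k, l, rfl⟩ := hrep b
    simp only [map_mul, map_pow]
    exact (((Commute.refl _).pow_pow _ _).mul_right (hf.symm.pow_pow _ _)).mul_left
      ((hf.pow_pow _ _).mul_right ((Commute.refl _).pow_pow _ _))
  exact (Subgroup.mem_center_iff.1 (Subgroup.zpowers_le.2 hZc hab) c).symm

theorem numRelCsd_eq_one_of_isModularMaxCyclic {G : Type*} [Group G] [Finite G]
    (hG : NonNormalConjugate G) (hM : IsModularMaxCyclic G) : numRelCsd G = 1 := by
  obtain ⟨p, n, hp, hn, ⟨e⟩⟩ := hM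
  refine numRelCsd_eq_one_of_commutator_central hG fun a b c => ?_
  have h := modular_commutator_central (by omega) (e a) (e b) (e c) hp
  rw [← map_commutatorElement] at h
  exact e.injective (by simpa using h.eq)

/-! ### Subgroups of prime index. -/

section primeIndex

variable {G : Type*} [Group G]

theorem Subgroup.eq_or_eq_top_of_index_prime {A S : Subgroup G} (hA : A.index.Prime) (h : A ≤ S) :
    S = A ∨ S = ⊤ := by
  have h1 := Subgroup.relIndex_mul_index h
  rcases hA.eq_one_or_self_of_dvd _ (Dvd.intro _ h1) with h2 | h2
  · left
    exact le_antisymm (Subgroup.relIndex_eq_one.1 h2) h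
  · right
    rw [h2] at h1
    exact Subgroup.index_eq_one.1 (Nat.eq_of_mul_eq_mul_left hA.pos (by rw [h1, mul_one]))

/-- A subgroup of prime index permutes with none of its other conjugates. -/
theorem map_conj_eq_of_mul_comm [Finite G] {A : Subgroup G} (hA : A.index.Prime) {g : G}
    (h : (A : Set G) * (A.map (MulAut.conj g).toMonoidHom : Subgroup G) =
      (A.map (MulAut.conj g).toMonoidHom : Subgroup G) * (A : Set G)) :
    A.map (MulAut.conj g).toMonoidHom = A := by
  set B := A.map (MulAut.conj g).toMonoidHom with hB
  let S : Subgroup G :=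
    { carrier := (A : Set G) * B
      mul_mem' := by
        rintro a b ha hb
        have : a * b ∈ ((A : Set G) * B) * ((A : Set G) * B) := Set.mul_mem_mul ha hb
        rwa [mul_assoc, ← mul_assoc (B : Set G), ← h, mul_assoc (A : Set G), coe_mul_coe,
          ← mul_assoc, coe_mul_coe] at this
      one_mem' := ⟨1, A.one_mem, 1, B.one_mem, one_mul 1⟩
      inv_mem' := by
        rintro _ ⟨a, ha, b, hb, rfl⟩
        show (a * b)⁻¹ ∈ (A : Set G) * B
        rw [h, mul_inv_rev]
        exact Set.mul_mem_mul (inv_mem hb) (inv_mem ha) }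
  have hAS : A ≤ S := fun a ha => ⟨a, ha, 1, B.one_mem, mul_one a⟩
  have hBS : B ≤ S := fun b hb => ⟨1, A.one_mem, b, hb, one_mul b⟩
  rcases Subgroup.eq_or_eq_top_of_index_prime hA hAS with hS | hS
  · exact Subgroup.eq_of_le_of_card_ge (hS ▸ hBS) (card_map_conj A g).ge
  -- Writing `g⁻¹ = a * (g * b * g⁻¹)` gives `g = a⁻¹ * b⁻¹ ∈ A`.
  · have hg : g⁻¹ ∈ S := hS ▸ Subgroup.mem_top _
    obtain ⟨a, ha, _, ⟨b, hb, rfl⟩, hab⟩ := hg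
    have hab : a * (g * b * g⁻¹) = g⁻¹ := hab
    have hgA : g ∈ A := by
      have : g = a⁻¹ * b⁻¹ := by
        rw [← mul_assoc, mul_eq_right] at hab
        rw [← mul_assoc] at hab
        rw [eq_mul_inv_iff_mul_eq, eq_comm, inv_eq_iff_mul_eq_one, ← mul_assoc, hab]
      rw [this]
      exact mul_mem (inv_mem ha) (inv_mem hb)
    refine Subgroup.eq_of_le_of_card_ge ?_ (card_map_conj A g).ge
    rintro _ ⟨b, hb, rfl⟩
    exact mul_mem (mul_mem hgA hb) (inv_mem hgA)

end primeIndex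

/-! ### The degrees in type (1). -/

section semidirect

variable {G : Type*} [Group G]

theorem not_normal_of_isComplement_of_isCyclic (hN : ∃ H : Subgroup G, ¬ H.Normal)
    {N P : Subgroup G} [hNn : N.Normal] (hc : N.IsComplement' P) [IsCyclic N] [IsCyclic P] :
    ¬ P.Normal := by
  intro hP
  have hNP := Subgroup.commute_of_normal_of_disjoint N P hNn hP hc.disjoint
  have hcomm : ∀ a b : G, Commute a b := by
    have hNN : ∀ a ∈ N, ∀ b ∈ N, Commute a b := fun a ha b hb =>
      congrArg Subtype.val (mul_comm' (⟨a, ha⟩ : N) ⟨b, hb⟩)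
    have hPP : ∀ a ∈ P, ∀ b ∈ P, Commute a b := fun a ha b hb =>
      congrArg Subtype.val (mul_comm' (⟨a, ha⟩ : P) ⟨b, hb⟩)
    intro a b
    obtain ⟨⟨⟨a1, h1⟩, ⟨a2, h2⟩⟩, rfl⟩ := hc.2 a
    obtain ⟨⟨⟨b1, k1⟩, ⟨b2, k2⟩⟩, rfl⟩ := hc.2 b
    exact ((hNN a1 h1 b1 k1).mul_right (hNP a1 b2 h1 k2)).mul_left
      ((hNP b1 a2 k1 h2).symm.mul_right (hPP a2 h2 b2 k2))
  obtain ⟨H, hH⟩ := hN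
  exact hH ⟨fun x hx g => by rwa [(hcomm g x).eq, mul_inv_cancel_right]⟩

/-- A normal subgroup of `N ⋊ P` (with `|N|` prime and `P` a `q`-group) not containing `N` lies
in `P`. -/
theorem le_of_normal_of_not_le [Finite G] {N P A : Subgroup G} [hNn : N.Normal] (hc : N.IsComplement' P)
    {q : ℕ} [Fact q.Prime] (hNp : (Nat.card N).Prime) (hPq : IsPGroup q P)
    (hq : ¬ q ∣ Nat.card N) (hA : A.Normal) (hNA : ¬ N ≤ A) : A ≤ P := by
  have hidx : P.index = Nat.card N := hc.index_eq_card
  have hdis : Disjoint A N := by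
    rw [disjoint_iff]
    have h1 : Nat.card (A ⊓ N : Subgroup G) ∣ Nat.card N := Subgroup.card_dvd_of_le inf_le_right
    rcases hNp.eq_one_or_self_of_dvd _ h1 with h2 | h2
    · exact Subgroup.card_eq_one.1 h2
    · exact absurd (inf_eq_right.1 (Subgroup.eq_of_le_of_card_ge inf_le_right h2.ge)) hNA
  have hAq : IsPGroup q A := by
    obtain ⟨n, hn⟩ := IsPGroup.iff_card.1 hPq
    refine IsPGroup.of_card_dvd_pow (n := n) ?_
    rw [← hn, ← hc.symm.index_eq_card]
    -- `A` embeds in `G / N`, of order `|P|`; as a normal `q`-group it lies in every Sylow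
    -- `q`-subgroup.
    have h1 : Function.Injective ((QuotientGroup.mk' N).comp A.subtype) := by
      rw [injective_iff_map_eq_one]
      intro a ha
      have h2 : (a : G) ∈ N := (QuotientGroup.eq_one_iff _).1 ha
      exact Subtype.ext (Subgroup.disjoint_def.1 hdis a.2 h2)
    exact Subgroup.card_dvd_of_injective _ h1
  have hP' : ¬ q ∣ P.index := by rwa [hidx]
  exact hAq.le_sylow_of_normal (hPq.toSylow hP')

theorem numRelCsd_eq_three_of_isCyclicSemidirect [Finite G] (hG : NonNormalConjugate G)
    (hN : ∃ H : Subgroup G, ¬ H.Normal) (hS : IsCyclicSemidirect G) : numRelCsd G = 3 := by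
  obtain ⟨p, q, n, hp, hq, hqp, hn, N, P, hNn, hc, ⟨eN⟩, ⟨eP⟩, -⟩ := hS
  have hqF : Fact q.Prime := ⟨hq⟩
  have hNc : Nat.card N = p := 
    (Nat.card_congr (eN.toEquiv.trans Multiplicative.toAdd)).trans (Nat.card_zmod p)
  have hPc : Nat.card P = q ^ n := 
    (Nat.card_congr (eP.toEquiv.trans Multiplicative.toAdd)).trans (Nat.card_zmod (q ^ n))
  have hNcyc : IsCyclic N := isCyclic_of_surjective eN.symm eN.symm.surjective
  have hPcyc : IsCyclic P := isCyclic_of_surjective eP.symm eP.symm.surjective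
  have hPn : ¬ P.Normal := not_normal_of_isComplement_of_isCyclic hN hc
  have hp3 : 3 ≤ p := by
    have h1 : 0 < p - 1 := by have := hp.two_le; omega
    have := Nat.le_of_dvd h1 hqp
    have := hq.two_le
    omega
  have hqp' : ¬ q ∣ p := by
    intro h1
    have h2 := (Nat.prime_dvd_prime_iff_eq hq hp).1 h1
    have := Nat.le_of_dvd (by omega) hqp
    omega
  have hPp : IsPGroup q P := IsPGroup.of_card hPc
  have hidx : P.index = p := by rw [hc.index_eq_card, hNc]
  set Q : Sylow q G := hPp.toSylow (by rwa [hidx]) with hQ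
  have hQP : (Q : Subgroup G) = P := rfl
  set C : Set (Subgroup G) := {A | ¬ A.Normal} with hC
  have hCconj : ∀ A ∈ C, ∃ g : G, A = P.map (MulAut.conj g).toMonoidHom := fun A hA => hG P A hPn hA
  have hCcyc : ∀ A ∈ C, IsCyclic A := by
    intro A hA
    obtain ⟨g, rfl⟩ := hCconj A hA
    exact isCyclic_of_surjective _
      (P.equivMapOfInjective _ (MulAut.conj g).injective).surjective
  have hCcard : ∀ A ∈ C, Nat.card A = Nat.card P := by
    intro A hA
    obtain ⟨g, rfl⟩ := hCconj A hA
    exact card_map_conj P g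
  have hCidx : ∀ A ∈ C, A.index.Prime := by
    intro A hA
    have h1 := A.card_mul_index
    rw [hCcard A hA, ← P.card_mul_index] at h1
    rw [Nat.eq_of_mul_eq_mul_left Nat.card_pos h1, hidx]
    exact hp
  have hCcomm : ∀ A ∈ C, ∀ B ∈ C, (A : Set G) * (B : Set G) = (B : Set G) * (A : Set G) →
      A = B := by
    intro A hA B hB hAB
    obtain ⟨g, rfl⟩ := hG A B hA hB
    exact (map_conj_eq_of_mul_comm (hCidx A hA) hAB).symm
  have hCn : C.ncard = p := by
    have hself : Subgroup.normalizer (P : Set G) = P := by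
      by_contra hne
      exact hPn (Q.normal_of_normalizer_normal
        (hG.normal_of_gt hPn (lt_of_le_of_ne Subgroup.le_normalizer (Ne.symm hne))))
    have h1 : C = Set.range (fun S : Sylow q G => (S : Subgroup G)) := by
      ext A
      constructor
      · intro hA
        obtain ⟨g, rfl⟩ := hCconj A hA
        exact ⟨g • Q, rfl⟩
      · rintro ⟨S, rfl⟩ hSn
        have := Sylow.unique_of_normal S hSn
        apply hPn
        rw [← hQP, Subsingleton.elim Q S]
        exact hSn
    have h2 : Nat.card (Sylow q G) = p := by
      rw [Q.card_eq_index_normalizer, ← hidx, ← hself]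
      rfl
    rw [h1, ← h2, ← Nat.card_coe_set_eq]
    exact Nat.card_range_of_injective fun S T h => Sylow.ext h
  set D : Set (Subgroup G) := {B | B < P} with hD
  set d := D.ncard with hd
  set L := (cyclicSubgroups (⊤ : Subgroup G)).ncard with hL
  have hL0 : 0 < L := ncard_cyclicSubgroups_pos ⊤
  have hd1 : 1 ≤ d := by
    refine (Set.ncard_pos (Set.toFinite _)).2 ⟨⊥, ?_⟩
    show (⊥ : Subgroup G) < P
    exact bot_lt_iff_ne_bot.2 fun h1 => hPn (h1 ▸ inferInstance)
  -- Proper subgroups of `P` are normal, so all conjugates of `P` share the same `d` proper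
  -- subgroups.
  have hLP : ∀ A ∈ C, (cyclicSubgroups A).ncard = d + 1 := by
    intro A hA
    have hAD : cyclicSubgroups A = insert A D := by
      ext B
      constructor
      · rintro ⟨hBA, -⟩
        rcases eq_or_lt_of_le hBA with h1 | h1
        · exact Or.inl h1
        · right
          have hBn := hG.normal_of_lt hA h1
          obtain ⟨g, rfl⟩ := hCconj A hA
          have h2 : B ≤ P := by
            intro b hb
            obtain ⟨a, ha, hab⟩ := hBA (hBn.conj_mem b hb g)
            have : a = b := (MulAut.conj g).injective hab
            rwa [← this]
          exact lt_of_le_of_ne h2 fun h3 => hPn (h3 ▸ hBn)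
      · have hle : ∀ B, B ≤ A → B ∈ cyclicSubgroups A := by
          intro B hB
          have := hCcyc A hA
          exact ⟨hB, isCyclic_of_surjective _ (Subgroup.subgroupOfEquivOfLe hB).surjective⟩
        rintro (rfl | hB)
        · exact hle _ le_rfl
        · have hB : B < P := hB
          have hBn := hG.normal_of_lt hPn hB
          obtain ⟨g, rfl⟩ := hCconj A hA
          refine hle _ fun b hb => ⟨g⁻¹ * b * g, hB.le ?_, by simp [mul_assoc]⟩
          simpa using hBn.conj_mem b hb g⁻¹
    rw [hAD, Set.ncard_insert_of_notMem ?_ (Set.toFinite _)]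
    intro h1
    exact hA (hG.normal_of_lt hPn h1)
  have hLle : L ≤ p + 2 * d := by
    set E : Set (Subgroup G) := {A | A.Normal ∧ IsCyclic A} with hE
    have h1 : cyclicSubgroups (⊤ : Subgroup G) ⊆ C ∪ E := by
      rintro A ⟨-, hA⟩
      by_cases hAn : A.Normal
      · exact Or.inr ⟨hAn, hA⟩
      · exact Or.inl hAn
    have h2 : E.ncard ≤ d * 2 := by
      classical
      have h3 : (D ×ˢ (Set.univ : Set Bool)).ncard = d * 2 := by
        rw [Set.ncard_prod, Set.ncard_univ, Nat.card_eq_fintype_card, Fintype.card_bool]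
      rw [← h3]
      -- The pair recovers a normal `A`: `A = N(A ∩ P)` if `N ≤ A`, and `A ≤ P` otherwise. Its first
      -- entry is proper, since a normal cyclic `A ≥ P` would be `P` or `G` and make `P` normal.
      refine Set.ncard_le_ncard_of_injOn (fun A => (A ⊓ P, decide (N ≤ A))) ?_ ?_ (Set.toFinite _)
      · rintro A ⟨hAn, hAc⟩
        refine ⟨?_, Set.mem_univ _⟩
        show A ⊓ P < P
        refine lt_of_le_of_ne inf_le_right fun h4 => ?_
        have h5 : P ≤ A := inf_eq_right.1 h4
        have hc' : IsMulCommutative A := inferInstance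
        apply hPn
        rcases Subgroup.eq_or_eq_top_of_index_prime (by rw [hidx]; exact hp) h5 with h6 | h6
        · rwa [← h6]
        · refine ⟨fun x hx g => ?_⟩
          have h7 : g * x = x * g := congrArg Subtype.val
            (mul_comm' (⟨g, h6 ▸ Subgroup.mem_top g⟩ : A) ⟨x, h5 hx⟩)
          rwa [h7, mul_inv_cancel_right]
      · have hrec : ∀ A : Subgroup G, N ≤ A → A = N ⊔ (A ⊓ P) := by
          intro A hNA
          refine le_antisymm ?_ (sup_le hNA inf_le_left)
          intro a ha
          obtain ⟨⟨⟨a1, h1⟩, ⟨a2, h2⟩⟩, rfl⟩ := hc.2 a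
          refine Subgroup.mul_mem_sup h1 ⟨?_, h2⟩
          have := mul_mem (inv_mem (hNA h1)) ha
          simpa using this
        rintro A ⟨hAn, -⟩ B ⟨hBn, -⟩ hAB
        simp only [Prod.mk.injEq, decide_eq_decide] at hAB
        obtain ⟨hAB1, hAB2⟩ := hAB
        by_cases hNA : N ≤ A
        · rw [hrec A hNA, hrec B (hAB2.1 hNA), hAB1]
        · have h4 : ∀ A : Subgroup G, A.Normal → ¬ N ≤ A → A ≤ P := fun A hA h =>
            le_of_normal_of_not_le hc (by rwa [hNc]) hPp (by rwa [hNc]) hA h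
          rw [← inf_eq_left.2 (h4 A hAn hNA), hAB1,
            inf_eq_left.2 (h4 B hBn fun h => hNA (hAB2.2 h))]
    calc L ≤ (C ∪ E).ncard := Set.ncard_le_ncard h1 (Set.toFinite _)
      _ ≤ C.ncard + E.ncard := Set.ncard_union_le C E
      _ ≤ p + 2 * d := by rw [hCn]; omega
  have hbad : ∀ H : Subgroup G,
      nonPermutingPairs H = {x | x.1 ∈ C ∧ x.1 ≤ H ∧ x.2 ∈ C ∧ x.1 ≠ x.2} := by
    intro H
    ext x
    constructor
    · intro hx
      obtain ⟨h1, h2⟩ := not_normal_of_mem_nonPermutingPairs hx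
      exact ⟨h1, hx.1.1, h2, fun h => hx.2.2 (by rw [h])⟩
    · rintro ⟨h1, h2, h3, h4⟩
      exact ⟨⟨h2, hCcyc _ h1⟩, ⟨le_top, hCcyc _ h3⟩, fun h => h4 (hCcomm _ h1 _ h3 h)⟩
  have hcsdC : ∀ A ∈ C, csd A = 1 - ((p : ℚ) - 1) / ((d + 1) * L) := by
    intro A hA
    have h1 : nonPermutingPairs A = {A} ×ˢ (C \ {A}) := by
      rw [hbad]
      ext ⟨B, B'⟩
      constructor
      · rintro ⟨h1, h2, h3, h4⟩
        have h5 : B = A := Subgroup.eq_of_le_of_card_ge h2 (by rw [hCcard A hA, hCcard B h1])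
        exact ⟨h5, h3, fun h6 => h4 (h5.trans h6.symm)⟩
      · rintro ⟨h1, h2, h3⟩
        obtain rfl : B = A := h1
        exact ⟨hA, le_rfl, h2, fun h => h3 h.symm⟩
    have h2 : (C \ {A}).ncard = p - 1 := by
      rw [Set.ncard_sdiff_singleton_of_mem hA, hCn]
    rw [csd_eq_one_sub, hLP A hA, h1, Set.ncard_prod, Set.ncard_singleton, one_mul, h2,
      Nat.cast_sub hp.one_lt.le]
    push_cast
    rfl
  have hcsdT : csd (⊤ : Subgroup G) = 1 - ((p : ℚ) * (p - 1)) / (L * L) := by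
    have h1 : nonPermutingPairs (⊤ : Subgroup G) = C.offDiag := by
      rw [hbad]
      ext ⟨B, B'⟩
      simp [Set.mem_offDiag]
    have h2 : C.offDiag.ncard = p * (p - 1) := by
      classical
      have := Fintype.ofFinite C
      rw [Set.ncard_eq_toFinset_card', Set.toFinset_offDiag, Finset.offDiag_card,
        ← Set.ncard_eq_toFinset_card', hCn, Nat.mul_sub_one]
    rw [csd_eq_one_sub, h1, h2, Nat.cast_mul, Nat.cast_sub hp.one_lt.le, Nat.cast_one]
  have hcsd1 : ∀ H : Subgroup G, (∀ A ∈ C, ¬ A ≤ H) → csd H = 1 := by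
    intro H hH
    have h1 : nonPermutingPairs H = ∅ := by
      rw [hbad, Set.eq_empty_iff_forall_notMem]
      rintro x ⟨h1, h2, -⟩
      exact hH _ h1 h2
    rw [csd_eq_one_sub, h1]
    simp
  set v₁ : ℚ := 1 - ((p : ℚ) - 1) / ((d + 1) * L) with hv₁
  set v₂ : ℚ := 1 - ((p : ℚ) * (p - 1)) / (L * L) with hv₂
  have hrange : (Set.range fun H : Subgroup G => csd H) = {1, v₁, v₂} := by
    ext v
    constructor
    · rintro ⟨H, rfl⟩
      by_cases hH : ∀ A ∈ C, ¬ A ≤ H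
      · exact Or.inl (hcsd1 H hH)
      · push Not at hH
        obtain ⟨A, hA, hAH⟩ := hH
        right
        rcases Subgroup.eq_or_eq_top_of_index_prime (hCidx A hA) hAH with rfl | rfl
        · exact Or.inl (hcsdC _ hA)
        · exact Or.inr hcsdT
    · rintro (rfl | rfl | rfl)
      · refine ⟨⊥, hcsd1 ⊥ fun A hA h => hA ?_⟩
        rw [le_bot_iff.1 h]
        infer_instance
      · exact ⟨P, hcsdC P hPn⟩
      · exact ⟨⊤, hcsdT⟩
  have hLq : (0 : ℚ) < L := by exact_mod_cast hL0
  have hpq : (3 : ℚ) ≤ p := by exact_mod_cast hp3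
  have hdq : (1 : ℚ) ≤ d := by exact_mod_cast hd1
  have hLleq : (L : ℚ) ≤ p + 2 * d := by exact_mod_cast hLle
  have hx₁ : 0 < ((p : ℚ) - 1) / ((d + 1) * L) :=
    div_pos (by linarith) (mul_pos (by linarith) hLq)
  -- This amounts to `L < p * (d + 1)`, which follows from `L ≤ p + 2 * d` as `p ≥ 3` and `d ≥ 1`.
  have hlt : ((p : ℚ) - 1) / ((d + 1) * L) < ((p : ℚ) * (p - 1)) / (L * L) := by
    rw [div_lt_div_iff₀ (mul_pos (by linarith) hLq) (mul_pos hLq hLq)]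
    have h1 : (L : ℚ) < p * (d + 1) := by nlinarith
    have h2 : 0 < ((p : ℚ) - 1) * L := mul_pos (by linarith) hLq
    nlinarith [mul_lt_mul_of_pos_left h1 h2]
  rw [numRelCsd, hrange, Set.ncard_eq_three]
  refine ⟨1, v₁, v₂, ?_, ?_, ?_, rfl⟩
  · rw [hv₁]; intro h; linarith
  · rw [hv₂]; intro h; linarith
  · rw [hv₁, hv₂]; intro h; linarith

end semidirect

theorem theorem3p9 (G : Type*) [Group G] [Finite G] (hG : gammaNonNormal G = 1) :
    (IsCyclicSemidirect G ∨ IsModularMaxCyclic G) ∧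
      (IsCyclicSemidirect G → numRelCsd G = 3) ∧
      (IsModularMaxCyclic G → numRelCsd G = 1) :=
  ⟨isCyclicSemidirect_or_isModularMaxCyclic (nonNormalConjugate_of_gamma hG)
      (exists_nonNormal_of_gamma hG),
    numRelCsd_eq_three_of_isCyclicSemidirect (nonNormalConjugate_of_gamma hG)
      (exists_nonNormal_of_gamma hG),
    numRelCsd_eq_one_of_isModularMaxCyclic (nonNormalConjugate_of_gamma hG)⟩
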